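/- Setting. Let $d\ge 1$, let $K\subseteq\mathbb R^d$ be a convex body (compact, convex, with non-empty interior) with diameter $\delta_K$, and write $|\cdot|$ for Lebesgue measure and $\|f\|_S:=\sup_{x\in S}|f(x)|$. Let $\mu=(\mu_j)_{j\ge1}$ be a sequence of real numbers with $0<\mu_1\le\mu_2\le\cdots$ such that $$\sum_{j=1}^\infty\frac1{\mu_j}>\delta_K\,e$$ (the sum may be infinite), and let $$N:=1+\sup\Big\{n\in\mathbb N:\ \sum_{j=1}^n\frac1{\delta_K\mu_j}<e\Big\},$$ which is a finite positive integer. Let $\tilde\mu:[1,\infty)\to(0,\infty)$ be any increasing, continuous, piecewise $C^1$ function with $\tilde\mu(k)=\mu_k$ for all integers $k\ge1$, and put $$\gamma(n):=\sup_{1\le s\le n}\frac{s\,\tilde\mu'(s)}{\tilde\mu(s)},\qquad C_N:=4\,e^{4+\gamma(2(N-1))},$$ where $\tilde\mu'$ is the left derivative (at $s=1$ the right derivative). Theorem. Assume $N\ge2$. Let $f:K\to\mathbb R$ be of class $C^{2(N-1)}$ in an open neighbourhood of $K$, with $\|f\|_K>0$ and $$\sum_{|\alpha|=j}\frac{j!}{\alpha!}\,\|f^{(\alpha)}\|_K\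 \le\ \|f\|_K\,\mu_1\mu_2\cdots\mu_j\qquad\text{for all }0\le j\le 2(N-1).$$ Then for every Lebesgue measurable $E\subseteq K$ with $|E|>0$, $$\|f\|_K\le\Big(\frac{C_N\,|K|^{1/d}}{|K|^{1/d}-(|K|-|E|)^{1/d}}\Big)^{2(N-1)}\|f\|_E .$$ -/

import Mathlib

open MeasureTheory Set Filter
open scoped ENNReal

noncomputable section

namespace RemezSmooth

/-- A positive, increasing, everywhere finite sequence `(μ_j)_{j ≥ 1}`
(the entry with index `0` plays no role). -/
structure IsAdmissibleWeight (μ : ℕ → ℝ) : Prop where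
  pos : ∀ j, 1 ≤ j → 0 < μ j
  mono : ∀ j k, 1 ≤ j → j ≤ k → μ j ≤ μ k

/-- Convex bodies: compact convex sets with non-empty interior. -/
structure IsConvexBody {d : ℕ} (K : Set (EuclideanSpace ℝ (Fin d))) : Prop where
  convex : Convex ℝ K
  compact : IsCompact K
  interior_nonempty : (interior K).Nonempty

/-- The supremum of `|f|` over `S`. It is only used for non-empty `S` on which `f` is bounded. -/
def supNorm {d : ℕ} (S : Set (EuclideanSpace ℝ (Fin d))) (f : EuclideanSpace ℝ (Fin d) → ℝ) : ℝ :=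
  ⨆ x : S, |f x|

/-- The partial derivative `∂_i f`. -/
def partialDeriv {d : ℕ} (i : Fin d) (f : EuclideanSpace ℝ (Fin d) → ℝ) :
    EuclideanSpace ℝ (Fin d) → ℝ :=
  fun x => lineDeriv ℝ f x (EuclideanSpace.single i 1)

/-- The partial derivative `f^{(α)} = ∂_1^{α_1} ⋯ ∂_d^{α_d} f` for a multi-index `α`. -/
def multiDeriv {d : ℕ} (α : Fin d → ℕ) (f : EuclideanSpace ℝ (Fin d) → ℝ) :
    EuclideanSpace ℝ (Fin d) → ℝ :=
  (List.finRange d).foldr (fun i g => (partialDeriv i)^[α i] g) f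

/-- `‖f‖_{j,S} = ∑_{|α| = j} (j! / α!) ‖f^{(α)}‖_S`. -/
def derivNorm {d : ℕ} (j : ℕ) (S : Set (EuclideanSpace ℝ (Fin d)))
    (f : EuclideanSpace ℝ (Fin d) → ℝ) : ℝ :=
  ∑ α ∈ Finset.piAntidiag (Finset.univ : Finset (Fin d)) j,
    ((j.factorial : ℝ) / ∏ i, ((α i).factorial : ℝ)) * supNorm S (multiDeriv α f)

/-- `f` is `(μ^{|n}, M₀)`-smooth on `K`, where `μ^{|n} = (μ_1, …, μ_n, ∞, ∞, …)`: it is of class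
`C^n` in an open neighbourhood of `K`, and `‖f‖_{j,K} ≤ M₀ μ_1 ⋯ μ_j` for all finite `j ≤ n`. -/
structure IsWeightSmooth {d : ℕ} (μ : ℕ → ℝ) (n : ℕ∞) (M₀ : ℝ)
    (K : Set (EuclideanSpace ℝ (Fin d))) (f : EuclideanSpace ℝ (Fin d) → ℝ) : Prop where
  pos : 0 < M₀
  contDiff : ∃ U : Set (EuclideanSpace ℝ (Fin d)), IsOpen U ∧ K ⊆ U ∧ ContDiffOn ℝ n f U
  bound : ∀ j : ℕ, (j : ℕ∞) ≤ n → derivNorm j K f ≤ M₀ * ∏ i ∈ Finset.Icc 1 j, μ i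

/-- `Σ_μ(m, n) = ∑_{j = m}^n 1 / μ_j` (zero if `m > n`). -/
def weightSum (μ : ℕ → ℝ) (m n : ℕ) : ℝ :=
  ∑ j ∈ Finset.Icc m n, 1 / μ j

/-- `Σ_μ(m, ∞) = ∑_{j ≥ m} 1 / μ_j`, possibly infinite. -/
def weightSumTop (μ : ℕ → ℝ) (m : ℕ) : ℝ≥0∞ :=
  ∑' j : ℕ, ENNReal.ofReal (1 / μ (m + j))

/-- `j₀(b)`, the smallest natural number `j` with `j ≥ log (1 / b)`. -/
def startIndex (b : ℝ) : ℕ := ⌈Real.log b⁻¹⌉₊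

/-- The `μ`-degree `sup {n ∈ ℕ : Σ_μ(j₀(b) + 1, n) < e}`, an element of `ℕ ∪ {∞}`. -/
def weightDegree (μ : ℕ → ℝ) (b : ℝ) : ℕ∞ :=
  ⨆ n ∈ {n : ℕ | weightSum μ (startIndex b + 1) n < Real.exp 1}, (n : ℕ∞)

/-- `(μ, K)` is admissible data: `Σ_μ(1, ∞) > diam(K) e`. -/
structure IsAdmissibleData {d : ℕ} (μ : ℕ → ℝ) (K : Set (EuclideanSpace ℝ (Fin d))) : Prop where
  weight : IsAdmissibleWeight μ
  convexBody : IsConvexBody K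
  sum_gt : ENNReal.ofReal (Metric.diam K * Real.exp 1) < weightSumTop μ 1

/-- `N` is the integer associated with the admissible data `(μ, K)`, that is, `N - 1` is the
degree, at `b = 1`, of the weight `(diam(K) μ_j)_j`. -/
def IsAssociatedInteger {d : ℕ} (μ : ℕ → ℝ) (K : Set (EuclideanSpace ℝ (Fin d))) (N : ℕ) : Prop :=
  (N : ℕ∞) = weightDegree (fun j => Metric.diam K * μ j) 1 + 1

/-- `g` is an increasing, positive, continuous, piecewise `C¹` function on `[1, ∞)` with
`g(k) = μ_k` for all integers `k ≥ 1`. -/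
structure IsInterpolation (μ : ℕ → ℝ) (g : ℝ → ℝ) : Prop where
  pos : ∀ s, 1 ≤ s → 0 < g s
  mono : MonotoneOn g (Ici 1)
  cont : ContinuousOn g (Ici 1)
  piecewise : ∃ t : ℕ → ℝ, StrictMono t ∧ t 0 = 1 ∧ Tendsto t atTop atTop ∧
    ∀ i, ContDiffOn ℝ 1 g (Icc (t i) (t (i + 1)))
  interp : ∀ k : ℕ, 1 ≤ k → g k = μ k

/-- The left derivative of a function on `[1, ∞)`; at the end point `1` the right derivative. -/
def leftDeriv (g : ℝ → ℝ) (s : ℝ) : ℝ :=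
  if s = 1 then derivWithin g (Ici 1) 1 else derivWithin g (Iic s) s

/-- `γ_g(n) = sup_{1 ≤ s ≤ n} s g'(s) / g(s)`. -/
def gammaExp (g : ℝ → ℝ) (n : ℕ) : ℝ :=
  ⨆ s : Icc (1 : ℝ) n, (s : ℝ) * leftDeriv g s / g s

/-- `Γ_g(n) = 4 exp(4 + γ_g(n))`. -/
def gammaConst (g : ℝ → ℝ) (n : ℕ) : ℝ :=
  4 * Real.exp (4 + gammaExp g n)

end RemezSmooth

end

/-! The problem reduces to one variable, where Bang's theorem on large derivatives is played against
interpolation on the set where `f` is small.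

Let |f| attain its maximum M on K at x. In polar coordinates around x, if every segment from x met a
set in proportion at most m/2, that set would fill at most the fraction 1 - (1 - m/2)^d of K
(`ofReal_pow_mul_measure_le_of_segments`). With 1 - m = ((|K| - |E|)/|K|)^(1/d) this is too little,
so some segment from x carries |f| ≤ ‖f‖_E on a set of proportion at least m/2 (`exists_segment`).
On that segment g(t) = f(x + t(y - x))/M satisfies |g(0)| = 1, and its derivatives are bounded by
M_j = λ_1 ⋯ λ_j with λ_j = δ_K μ_j (`lineJet`, `abs_lineJet_le`).

Put n = N - 1. Since the reciprocals of λ_1, …, λ_{n+1} sum to at least e, Bang's argument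
(`exists_large_deriv`) shows that the derivatives of order at most n cannot all be small at any
point: otherwise smallness could be carried back to 0, one order being lost on each step of length
1/(e λ_k), contradicting |g(0)| = 1.

Cut [0,1] into intervals of length h comparable to n/λ_{2n}, choose one where the small set is
dense, and interpolate g at 2n well spaced points of it (`abs_deriv_le_of_nodes`). For this h the
interpolation error is at most half of Bang's lower bound, so a derivative of the interpolating
polynomial is large. Lagrange's formula bounds that derivative by a multiple of the size of g at the
nodes, which gives the inequality (`one_le_mul_of_small_on`). The exponent γ enters only in
comparing M_j with λ_{2n}^j (`pow_mul_exp_le_prod_weight`). -/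

namespace RemezSmooth

/-! ### Bang's theorem on large derivatives -/

/-- One step of Bang's argument: smallness of the jet of order `< k` at `y` propagates. -/
theorem abs_deriv_le_exp_of_small {G : ℕ → ℝ → ℝ} {M : ℕ → ℝ} {y s r : ℝ} {k : ℕ} (hr : 0 ≤ r)
    (hderiv : ∀ j < k, ∀ t ∈ Icc (y - s) y, HasDerivAt (G j) (G (j + 1) t) t)
    (hM : ∀ j < k, M (j + 1) ≤ r * M j) (hMk : 0 ≤ M k)
    (hG : ∀ t ∈ Icc (y - s) y, |G k t| ≤ M k)
    (hy : ∀ j < k, |G j y| ≤ Real.exp (j - k) * M j) :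
    ∀ j ≤ k, ∀ t ∈ Icc 0 s, |G j (y - t)| ≤ Real.exp (j - k) * M j * Real.exp (Real.exp 1 * r * t) := by
  suffices h : ∀ i j, j + i = k → ∀ t ∈ Icc 0 s,
      |G j (y - t)| ≤ Real.exp (j - k) * M j * Real.exp (Real.exp 1 * r * t) from
    fun j hj => h (k - j) j (by omega)
  intro i
  induction i with
  | zero =>
    rintro j rfl t ht
    have h1 : 1 ≤ Real.exp (Real.exp 1 * r * t) :=
      Real.one_le_exp (mul_nonneg (mul_nonneg (Real.exp_pos 1).le hr) ht.1)
    have h2 := hG (y - t) ⟨by linarith [ht.2], by linarith [ht.1]⟩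
    simp only [add_zero] at *
    rw [sub_self, Real.exp_zero, one_mul]
    nlinarith
  | succ i ih =>
    intro j hj
    have hjk : j < k := by omega
    have hder : ∀ t ∈ Icc 0 s, HasDerivAt (fun t => G j (y - t)) (-G (j + 1) (y - t)) t := by
      intro t ht
      exact HasDerivAt.comp_const_sub y t
        (hderiv j hjk (y - t) ⟨by linarith [ht.2], by linarith [ht.1]⟩)
    -- The induction descends from order k. Because M (j+1) ≤ r * M j, the bound already known at
    -- level j + 1 is at most the derivative of the bound claimed at level j.
    refine image_norm_le_of_norm_deriv_right_le_deriv_boundary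
      (f := fun t => G j (y - t)) (f' := fun t => -G (j + 1) (y - t))
      (B := fun t => Real.exp (j - k) * M j * Real.exp (Real.exp 1 * r * t))
      (B' := fun t => Real.exp (j - k) * M j * (Real.exp (Real.exp 1 * r * t) * (Real.exp 1 * r)))
      (fun t ht => (hder t ht).continuousAt.continuousWithinAt)
      (fun t ht => (hder t ⟨ht.1, ht.2.le⟩).hasDerivWithinAt) ?_ ?_ ?_
    · simpa using hy j hjk
    · intro t
      have h1 : HasDerivAt (fun t => Real.exp 1 * r * t) (Real.exp 1 * r) t := by
        simpa using (hasDerivAt_id t).const_mul (Real.exp 1 * r)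
      exact h1.exp.const_mul _
    · intro t ht
      have h1 := ih (j + 1) (by omega) t ⟨ht.1, ht.2.le⟩
      have h2 : Real.exp (((j + 1 : ℕ) : ℝ) - k) = Real.exp (j - k) * Real.exp 1 := by
        rw [← Real.exp_add]; congr 1; push_cast; ring
      rw [norm_neg, Real.norm_eq_abs]
      refine h1.trans ?_
      rw [h2]
      calc Real.exp (j - k) * Real.exp 1 * M (j + 1) * Real.exp (Real.exp 1 * r * t)
          ≤ Real.exp (j - k) * Real.exp 1 * (r * M j) * Real.exp (Real.exp 1 * r * t) := by
            gcongr; exact hM j hjk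
        _ = _ := by ring

/-- Bang's theorem: at every point some derivative of order `≤ n` is large. -/
theorem exists_large_deriv {G : ℕ → ℝ → ℝ} {lam : ℕ → ℝ} {n : ℕ}
    (hpos : ∀ j, 1 ≤ j → 0 < lam j) (hmono : ∀ j k, 1 ≤ j → j ≤ k → lam j ≤ lam k)
    (hderiv : ∀ j < n + 1, ∀ t ∈ Icc (0 : ℝ) 1, HasDerivAt (G j) (G (j + 1) t) t)
    (hG : ∀ j ≤ n + 1, ∀ t ∈ Icc (0 : ℝ) 1, |G j t| ≤ ∏ i ∈ Finset.Icc 1 j, lam i)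
    (h0 : |G 0 0| = 1)
    (hsum : Real.exp 1 ≤ ∑ i ∈ Finset.Icc 1 (n + 1), 1 / lam i)
    {x : ℝ} (hx : x ∈ Icc (0 : ℝ) 1) :
    ∃ j ≤ n, Real.exp (j - (n + 1)) * (∏ i ∈ Finset.Icc 1 j, lam i) < |G j x| := by
  have hMpos : ∀ j, 0 < ∏ i ∈ Finset.Icc 1 j, lam i := fun j =>
    Finset.prod_pos fun i hi => hpos i (Finset.mem_Icc.1 hi).1
  -- Smallness of the jet of order < k at y reaches 0 as long as y lies within the total length of k
  -- steps, the step at level i having length 1/(e λ_i).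
  have key : ∀ k, 1 ≤ k → k ≤ n + 1 → ∀ y ∈ Icc (0 : ℝ) 1,
      Real.exp 1 * y ≤ ∑ i ∈ Finset.Icc 1 k, 1 / lam i →
      (∀ j < k, |G j y| ≤ Real.exp (j - k) * (∏ i ∈ Finset.Icc 1 j, lam i)) → |G 0 0| < 1 := by
    intro k hk
    induction k, hk using Nat.le_induction with
    -- The exponential estimate would only give |G 0 0| ≤ e⁻¹ · e = 1, so the last step uses the
    -- mean value inequality, which gives 2/e < 1.
    | base =>
      intro _ y hy hys hsm
      have h1 : |G 0 y| ≤ Real.exp (-1) := by simpa using hsm 0 (by norm_num)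
      have h2 : ‖G 0 0 - G 0 y‖ ≤ lam 1 * ‖0 - y‖ := by
        refine Convex.norm_image_sub_le_of_norm_hasDerivWithin_le (f' := G 1) (s := Icc (0 : ℝ) 1)
          (fun t ht => (hderiv 0 (by omega) t ht).hasDerivWithinAt) (fun t ht => ?_)
          (convex_Icc _ _) hy ⟨le_rfl, zero_le_one⟩
        simpa using hG 1 (by omega) t ht
      have h3 : Real.exp 1 * y ≤ 1 / lam 1 := by simpa using hys
      have h4 : lam 1 * y ≤ Real.exp (-1) := by
        have := hpos 1 le_rfl
        rw [le_div_iff₀ this] at h3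
        rw [Real.exp_neg, ← one_div, le_div_iff₀ (Real.exp_pos 1)]
        linarith
      have h5 : Real.exp (-1) < 1 / 2 := by
        rw [Real.exp_neg, ← one_div]
        exact one_div_lt_one_div_of_lt (by norm_num) (by linarith [Real.exp_one_gt_d9])
      rw [zero_sub, norm_neg, Real.norm_eq_abs, Real.norm_eq_abs, abs_of_nonneg hy.1] at h2
      have h6 := abs_sub_abs_le_abs_sub (G 0 0) (G 0 y)
      linarith
    | succ k hk ih =>
      intro hkn y hy hys hsm
      have hl := hpos (k + 1) (by omega)
      have step : ∀ s, 0 ≤ s → s ≤ y → ∀ j ≤ k + 1, |G j (y - s)| ≤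
          Real.exp (j - (k + 1 : ℕ)) * (∏ i ∈ Finset.Icc 1 j, lam i) *
            Real.exp (Real.exp 1 * lam (k + 1) * s) := by
        intro s hs0 hsy j hj
        have hsub : ∀ t ∈ Icc (y - s) y, t ∈ Icc (0 : ℝ) 1 := fun t ht =>
          ⟨by linarith [ht.1], ht.2.trans hy.2⟩
        refine abs_deriv_le_exp_of_small (M := fun j => ∏ i ∈ Finset.Icc 1 j, lam i) (s := s) hl.le
          (fun j hj t ht => hderiv j (by omega) t (hsub t ht)) ?_ (hMpos _).le
          (fun t ht => hG _ hkn t (hsub t ht)) hsm j hj s ⟨hs0, le_rfl⟩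
        intro j hj
        rw [Finset.prod_Icc_succ_top (by omega), mul_comm]
        exact mul_le_mul_of_nonneg_right (hmono _ _ (by omega) (by omega)) (hMpos j).le
      rw [Finset.sum_Icc_succ_top (by omega)] at hys
      by_cases hcase : Real.exp 1 * y ≤ 1 / lam (k + 1)
      · have h1 := step y hy.1 le_rfl 0 (by omega)
        rw [sub_self] at h1
        refine h1.trans_lt ?_
        simp only [Nat.cast_zero, Finset.Icc_eq_empty_of_lt zero_lt_one, Finset.prod_empty, mul_one]
        rw [← Real.exp_add, Real.exp_lt_one_iff]
        rw [le_div_iff₀ hl] at hcase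
        have : (1 : ℝ) ≤ k := by exact_mod_cast hk
        push_cast
        nlinarith
      · push Not at hcase
        -- This step length makes the growth factor exactly e, which turns exp(j - (k+1)) into exp(j
        -- - k): the hypothesis one level down.
        set s := 1 / lam (k + 1) / Real.exp 1 with hs
        have hse : Real.exp 1 * s = 1 / lam (k + 1) := by
          rw [hs]; field_simp
        have hs0 : 0 ≤ s := by positivity
        have hsy : s ≤ y := by
          by_contra h
          push Not at h
          have := mul_lt_mul_of_pos_left h (Real.exp_pos 1)
          linarith
        refine ih (by omega) (y - s) ⟨by linarith, by linarith [hy.2]⟩ (by linarith) ?_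
        intro j hj
        have h1 := step s hs0 hsy j (by omega)
        have h2 : Real.exp 1 * lam (k + 1) * s = 1 := by
          rw [mul_right_comm, hse]; field_simp
        rw [h2] at h1
        refine h1.trans_eq ?_
        rw [mul_right_comm, ← Real.exp_add]
        congr 2
        push_cast
        ring
  by_contra hcon
  push Not at hcon
  have := key (n + 1) (by omega) le_rfl x hx
    (by nlinarith [hx.2, Real.exp_pos 1]) (fun j hj => by
      have := hcon j (by omega)
      push_cast
      exact this)
  linarith

/-! ### Rolle's theorem and functions with many zeros -/

/-- Iterated Rolle theorem for a family of successive derivatives. -/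
theorem exists_zeros_iterated_deriv {a b : ℝ} (j r : ℕ) {U : ℕ → ℝ → ℝ}
    (hU : ∀ i < j, ∀ t ∈ Icc a b, HasDerivAt (U i) (U (i + 1) t) t)
    {s : Finset ℝ} (hs : s.card = r + j) (hsab : ∀ z ∈ s, z ∈ Icc a b ∧ U 0 z = 0) :
    ∃ s' : Finset ℝ, s'.card = r ∧ ∀ z ∈ s', z ∈ Icc a b ∧ U j z = 0 := by
  induction j generalizing r with
  | zero => exact ⟨s, hs, hsab⟩
  | succ j ih =>
    obtain ⟨s₁, hs₁, hz₁⟩ := ih (r + 1) (fun i hi => hU i (by omega)) (by omega)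
    set z := s₁.orderEmbOfFin hs₁ with hz
    have hzmem : ∀ i, z i ∈ Icc a b ∧ U j (z i) = 0 := fun i =>
      hz₁ _ (s₁.orderEmbOfFin_mem hs₁ i)
    have hc : ∀ i : Fin r, ∃ c ∈ Ioo (z i.castSucc) (z i.succ), U (j + 1) c = 0 := by
      intro i
      have hsub : Icc (z i.castSucc) (z i.succ) ⊆ Icc a b :=
        Icc_subset_Icc (hzmem _).1.1 (hzmem _).1.2
      refine exists_hasDerivAt_eq_zero (z.strictMono i.castSucc_lt_succ)
        (fun t ht => (hU j (by omega) t (hsub ht)).continuousAt.continuousWithinAt)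
        (by rw [(hzmem _).2, (hzmem _).2])
        (fun t ht => hU j (by omega) t (hsub (Ioo_subset_Icc_self ht)))
    choose c hc hc0 using hc
    have hmono : StrictMono c := by
      intro i i' hii
      refine (hc i).2.trans_le (le_trans ?_ (hc i').1.le)
      exact z.monotone (Fin.succ_le_castSucc_iff.2 hii)
    refine ⟨Finset.univ.image c, ?_, ?_⟩
    · rw [Finset.card_image_of_injective _ hmono.injective]; simp
    · intro w hw
      obtain ⟨i, -, rfl⟩ := Finset.mem_image.1 hw
      exact ⟨⟨(hzmem _).1.1.trans (hc i).1.le, (hc i).2.le.trans (hzmem _).1.2⟩, hc0 i⟩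

theorem hasDerivAt_eval_iterate_derivative (P : Polynomial ℝ) (i : ℕ) (t : ℝ) :
    HasDerivAt (fun t => (Polynomial.derivative^[i] P).eval t)
      ((Polynomial.derivative^[i + 1] P).eval t) t := by
  rw [Function.iterate_succ_apply']
  exact Polynomial.hasDerivAt _ t

/-- The size of a function with many zeros on an interval. -/
theorem abs_le_of_zeros {a b A : ℝ} {k : ℕ} {U : ℕ → ℝ → ℝ}
    (hU : ∀ i < k, ∀ t ∈ Icc a b, HasDerivAt (U i) (U (i + 1) t) t)
    (hA : ∀ t ∈ Icc a b, |U k t| ≤ A)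
    {s : Finset ℝ} (hs : s.card = k) (hsab : ∀ z ∈ s, z ∈ Icc a b ∧ U 0 z = 0)
    {x : ℝ} (hx : x ∈ Icc a b) : |U 0 x| ≤ A * (b - a) ^ k / k.factorial := by
  classical
  have hA0 : 0 ≤ A := (abs_nonneg _).trans (hA x hx)
  have hab : 0 ≤ b - a := by linarith [hx.1, hx.2]
  by_cases hxs : x ∈ s
  · rw [(hsab x hxs).2, abs_zero]; positivity
  set Q : Polynomial ℝ := ∏ z ∈ s, (Polynomial.X - Polynomial.C z) with hQ
  have hQx : Q.eval x = ∏ z ∈ s, (x - z) := by simp [hQ, Polynomial.eval_prod]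
  have hQ0 : Q.eval x ≠ 0 := by
    rw [hQx, Finset.prod_ne_zero_iff]
    intro z hz h
    exact hxs (by rwa [sub_eq_zero.1 h])
  -- With this c, U 0 - c Q has the extra zero x, hence k + 1 zeros; its k-th derivative U k - c k!
  -- then vanishes somewhere, which bounds c.
  set c := U 0 x / Q.eval x with hc
  have hQk : Polynomial.derivative^[k] Q = (k.factorial : Polynomial ℝ) := by
    rw [hQ, Polynomial.iterate_derivative_prod_X_sub_C hs.ge, hs]
    simp
  obtain ⟨s', hs', hz'⟩ := exists_zeros_iterated_deriv (a := a) (b := b) k 1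
    (U := fun i t => U i t - c * (Polynomial.derivative^[i] Q).eval t) (s := insert x s)
    (fun i hi t ht => (hU i hi t ht).sub ((hasDerivAt_eval_iterate_derivative Q i t).const_mul c))
    (by rw [Finset.card_insert_of_notMem hxs, hs, add_comm]) (by
      intro z hz
      rcases Finset.mem_insert.1 hz with rfl | hz
      · exact ⟨hx, by simp [hc, div_mul_cancel₀ _ hQ0]⟩
      · refine ⟨(hsab z hz).1, ?_⟩
        have : Q.eval z = 0 := by
          rw [hQ, Polynomial.eval_prod]
          exact Finset.prod_eq_zero hz (by simp)
        simp [(hsab z hz).2, this])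
  obtain ⟨ξ, hξ⟩ : s'.Nonempty := Finset.card_pos.1 (by omega)
  obtain ⟨hξ1, hξ2⟩ := hz' ξ hξ
  rw [hQk] at hξ2
  simp only [Polynomial.eval_natCast] at hξ2
  have h1 : |c| * k.factorial ≤ A := by
    have := hA ξ hξ1
    rw [sub_eq_zero.1 hξ2, abs_mul, Nat.abs_cast] at this
    exact this
  have h2 : |Q.eval x| ≤ (b - a) ^ k := by
    rw [hQx, Finset.abs_prod, ← hs]
    refine (Finset.prod_le_prod (fun _ _ => abs_nonneg _) (g := fun _ => b - a) fun z hz => ?_).trans_eq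
      (Finset.prod_const _)
    have := (hsab z hz).1
    rw [abs_le]; constructor <;> linarith [hx.1, hx.2, this.1, this.2]
  have h3 : U 0 x = c * Q.eval x := by rw [hc, div_mul_cancel₀ _ hQ0]
  rw [h3, abs_mul, le_div_iff₀ (by positivity)]
  calc |c| * |Q.eval x| * k.factorial = (|c| * k.factorial) * |Q.eval x| := by ring
    _ ≤ A * (b - a) ^ k := by gcongr

end RemezSmooth

/-! ### Well spaced nodes and Lagrange interpolation -/

namespace RemezSmooth

/-- A compact set of measure greater than `k s` contains `k + 1` points with gaps at least `s`. -/
theorem exists_spaced_points {s : ℝ} (hs : 0 < s) (k : ℕ) {T : Set ℝ} (hT : IsCompact T)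
    (hvol : ENNReal.ofReal (k * s) < volume T) :
    ∃ z : ℕ → ℝ, (∀ i ≤ k, z i ∈ T) ∧ ∀ i j, i ≤ j → j ≤ k → ((j : ℝ) - i) * s ≤ z j - z i := by
  have hne : T.Nonempty := nonempty_of_measure_ne_zero (bot_lt_of_lt hvol).ne'
  induction k generalizing T with
  | zero =>
    obtain ⟨x, hx⟩ := hne
    refine ⟨fun _ => x, fun _ _ => hx, fun i j hij hj => ?_⟩
    obtain rfl : j = 0 := by omega
    obtain rfl : i = 0 := by omega
    simp
  | succ k ih =>
    set x := sInf T with hxdef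
    have hxT : x ∈ T := hT.sInf_mem hne
    have hxle : ∀ y ∈ T, x ≤ y := fun y hy => csInf_le hT.bddBelow hy
    have hT' : IsCompact (T ∩ Ici (x + s)) := hT.inter_right isClosed_Ici
    -- Greedy choice: take the leftmost point and discard the next length s. The measure drops by at
    -- most s, so the strict inequality survives.
    have hsub : T ⊆ Ico x (x + s) ∪ T ∩ Ici (x + s) := by
      intro y hy
      rcases lt_or_ge y (x + s) with h | h
      · exact Or.inl ⟨hxle y hy, h⟩
      · exact Or.inr ⟨hy, h⟩
    have hvol' : ENNReal.ofReal (k * s) < volume (T ∩ Ici (x + s)) := by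
      by_contra hcon
      push Not at hcon
      have h1 : volume T ≤ ENNReal.ofReal s + ENNReal.ofReal (k * s) := by
        refine (measure_mono hsub).trans ((measure_union_le _ _).trans ?_)
        rw [Real.volume_Ico, add_sub_cancel_left]
        gcongr
      rw [← ENNReal.ofReal_add hs.le (by positivity)] at h1
      refine absurd (hvol.trans_le h1) (not_lt.2 (ENNReal.ofReal_le_ofReal ?_))
      push_cast
      linarith
    obtain ⟨z, hz1, hz2⟩ := ih hT' hvol' (nonempty_of_measure_ne_zero (bot_lt_of_lt hvol').ne')
    refine ⟨fun i => Nat.casesOn i x z, ?_, ?_⟩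
    · rintro (_ | i) hi
      · exact hxT
      · exact (hz1 i (by omega)).1
    · rintro (_ | i) (_ | j) hij hj
      · simp
      · have h1 := hz2 0 j (by omega) (by omega)
        have h2 : x + s ≤ z 0 := (hz1 0 (by omega)).2
        simp only [Nat.cast_zero, sub_zero] at h1 ⊢
        change ((j + 1 : ℕ) : ℝ) * s ≤ z j - x
        push_cast
        linarith
      · omega
      · have h1 := hz2 i j (by omega) (by omega)
        push_cast
        simpa using h1

/-- The distance from z i to z j is at least |i - j| s; the nodes to the left contribute i! and
those to the right (k - i)!. These are the denominators in Lagrange's formula, and they will turn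
into binomial coefficients. -/
theorem factorial_mul_pow_le_prod_abs_sub {z : ℕ → ℝ} {s : ℝ} (hs : 0 < s) {i k : ℕ} (hik : i ≤ k)
    (hz : ∀ i j, i ≤ j → j ≤ k → ((j : ℝ) - i) * s ≤ z j - z i) :
    (i.factorial * (k - i).factorial : ℝ) * s ^ k ≤
      ∏ j ∈ (Finset.range (k + 1)).erase i, |z i - z j| := by
  induction k, hik using Nat.le_induction with
  | base =>
    have h1 : (Finset.range (i + 1)).erase i = Finset.range i := by
      ext; simp; omega
    rw [h1, Nat.sub_self, Nat.factorial_zero, Nat.cast_one, mul_one, Nat.factorial_eq_prod_range_add_one,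
      ← Finset.prod_range_reflect, Nat.cast_prod]
    nth_rewrite 3 [← Finset.card_range i]
    rw [← Finset.prod_const, ← Finset.prod_mul_distrib]
    refine Finset.prod_le_prod (fun _ _ => by positivity) fun j hj => ?_
    have hj' := Finset.mem_range.1 hj
    refine le_trans ?_ (le_abs_self _)
    have h2 := hz j i hj'.le le_rfl
    have h3 : ((i - 1 - j + 1 : ℕ) : ℝ) = (i : ℝ) - j := by
      rw [show i - 1 - j + 1 = i - j by omega, Nat.cast_sub hj'.le]
    rw [h3]
    exact h2
  | succ k hik ih =>
    have h1 : (Finset.range (k + 1 + 1)).erase i =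
        insert (k + 1) ((Finset.range (k + 1)).erase i) := by
      ext; simp; omega
    rw [h1, Finset.prod_insert (by simp), show k + 1 - i = k - i + 1 by omega, Nat.factorial_succ,
      pow_succ]
    have h2 := ih fun i j hij hj => hz i j hij (by omega)
    have h3 := hz i (k + 1) (by omega) le_rfl
    have h4 : ((k - i + 1 : ℕ) : ℝ) * s ≤ |z i - z (k + 1)| := by
      rw [abs_sub_comm]
      refine le_trans (le_of_eq ?_) (h3.trans (le_abs_self _))
      push_cast [Nat.cast_sub hik]
      ring
    calc (i.factorial * ((k - i + 1) * (k - i).factorial : ℕ) : ℝ) * (s ^ k * s)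
        = (((k - i + 1 : ℕ) : ℝ) * s) * ((i.factorial * (k - i).factorial : ℝ) * s ^ k) := by
          push_cast; ring
      _ ≤ _ := by gcongr

/-- Derivatives of a polynomial that is small at well spaced nodes. -/
theorem abs_eval_iterate_derivative_le {z : ℕ → ℝ} {s h x ε : ℝ} {k j : ℕ} (hs : 0 < s)
    (hz : ∀ i j, i ≤ j → j ≤ k → ((j : ℝ) - i) * s ≤ z j - z i)
    {P : Polynomial ℝ} (hP : P.degree < (k + 1 : ℕ)) (hPz : ∀ i ≤ k, |P.eval (z i)| ≤ ε)
    (hx : ∀ i ≤ k, |x - z i| ≤ h) (hj : j ≤ k) :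
    |(Polynomial.derivative^[j] P).eval x| ≤
      ε * (2 / s) ^ k * (h ^ (k - j) / (k - j).factorial) := by
  have hε : 0 ≤ ε := (abs_nonneg _).trans (hPz 0 (by omega))
  have hh : 0 ≤ h := (abs_nonneg _).trans (hx 0 (by omega))
  have hinj : Set.InjOn z (Finset.range (k + 1) : Set ℕ) := by
    have key : ∀ a b, a < b → b ≤ k → z a < z b := fun a b hab hb => by
      have h1 := hz a b hab.le hb
      have h2 : (0 : ℝ) < (b : ℝ) - a := sub_pos.2 (by exact_mod_cast hab)
      nlinarith [mul_pos h2 hs]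
    intro a ha b hb hab
    simp only [Finset.coe_range, mem_Iio] at ha hb
    rcases lt_trichotomy a b with h1 | h1 | h1
    · exact absurd hab (key a b h1 (by omega)).ne
    · exact h1
    · exact absurd hab (key b a h1 (by omega)).ne'
  rw [Lagrange.eval_iterate_derivative_eq_sum hinj (by simpa using hP) (by simpa using Nat.lt_succ_of_le hj), abs_mul,
    Nat.abs_cast]
  have hterm : ∀ i ∈ Finset.range (k + 1),
      |P.eval (z i) / (∏ l ∈ (Finset.range (k + 1)).erase i, (z i - z l)) *
        ∑ t ∈ ((Finset.range (k + 1)).erase i).powersetCard ((Finset.range (k + 1)).card - (j + 1)),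
          ∏ a ∈ t, (x - z a)| ≤
      (ε / s ^ k * (k.choose j * h ^ (k - j)) / k.factorial) * k.choose i := by
    intro i hi
    have hik : i ≤ k := by simpa [Nat.lt_succ_iff] using hi
    rw [abs_mul, abs_div, Finset.abs_prod]
    -- The sum has one product of k - j factors, each at most h, for every choice of k - j among the
    -- k nodes other than z i.
    have h1 : |∑ t ∈ ((Finset.range (k + 1)).erase i).powersetCard
        ((Finset.range (k + 1)).card - (j + 1)), ∏ a ∈ t, (x - z a)| ≤ k.choose j * h ^ (k - j) := by
      refine (Finset.abs_sum_le_sum_abs _ _).trans ?_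
      refine (Finset.sum_le_card_nsmul _ _ (h ^ (k - j)) fun t ht => ?_).trans_eq ?_
      · obtain ⟨ht1, ht2⟩ := Finset.mem_powersetCard.1 ht
        rw [Finset.abs_prod]
        refine (Finset.prod_le_prod (fun _ _ => abs_nonneg _) (g := fun _ => h) fun a ha => ?_).trans_eq ?_
        · have := Finset.mem_of_mem_erase (ht1 ha)
          exact hx a (by simpa [Nat.lt_succ_iff] using this)
        · rw [Finset.prod_const, ht2]; simp
      · rw [Finset.card_powersetCard, Finset.card_erase_of_mem hi]
        simp only [Finset.card_range, Nat.add_sub_cancel, Nat.add_sub_add_right, nsmul_eq_mul]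
        rw [Nat.choose_symm hj]
    have h2 := factorial_mul_pow_le_prod_abs_sub hs hik hz
    have h3 : ((k.choose i : ℕ) : ℝ) = k.factorial / (i.factorial * (k - i).factorial) :=
      Nat.cast_choose ℝ hik
    calc |P.eval (z i)| / (∏ l ∈ (Finset.range (k + 1)).erase i, |z i - z l|) * _
        ≤ ε / ((i.factorial * (k - i).factorial : ℝ) * s ^ k) * (k.choose j * h ^ (k - j)) := by
          gcongr
          exact hPz i hik
      _ = _ := by
          rw [h3]
          field_simp
  calc (j.factorial : ℝ) * |∑ i ∈ Finset.range (k + 1), _|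
      ≤ j.factorial * ∑ i ∈ Finset.range (k + 1),
          (ε / s ^ k * (k.choose j * h ^ (k - j)) / k.factorial) * k.choose i := by
        gcongr
        exact (Finset.abs_sum_le_sum_abs _ _).trans (Finset.sum_le_sum hterm)
    _ = _ := by
        -- Summing the coefficients `k.choose i` produces the factor 2^k.
        rw [← Finset.mul_sum, ← Nat.cast_sum, Nat.sum_range_choose, Nat.cast_choose ℝ hj, div_pow]
        push_cast
        field_simp

/-- A derivative estimate for a function which is small on well spaced nodes. -/
theorem abs_deriv_le_of_nodes {a h s ε A x : ℝ} {k j : ℕ} {G : ℕ → ℝ → ℝ} (hs : 0 < s)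
    (hG : ∀ i < k + 1, ∀ t ∈ Icc a (a + h), HasDerivAt (G i) (G (i + 1) t) t)
    (hA : ∀ t ∈ Icc a (a + h), |G (k + 1) t| ≤ A)
    {z : ℕ → ℝ} (hzI : ∀ i ≤ k, z i ∈ Icc a (a + h)) (hzG : ∀ i ≤ k, |G 0 (z i)| ≤ ε)
    (hz : ∀ i j, i ≤ j → j ≤ k → ((j : ℝ) - i) * s ≤ z j - z i)
    (hx : x ∈ Icc a (a + h)) (hj : j ≤ k) :
    |G j x| ≤ A * h ^ (k + 1 - j) / (k + 1 - j).factorial +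
      ε * (2 / s) ^ k * (h ^ (k - j) / (k - j).factorial) := by
  classical
  have hmono : ∀ a b, a < b → b ≤ k → z a < z b := fun a b hab hb => by
    have h1 := hz a b hab.le hb
    have h2 : (0 : ℝ) < (b : ℝ) - a := sub_pos.2 (by exact_mod_cast hab)
    nlinarith [mul_pos h2 hs]
  have hinj : Set.InjOn z (Finset.range (k + 1) : Set ℕ) := by
    intro a ha b hb hab
    simp only [Finset.coe_range, mem_Iio] at ha hb
    rcases lt_trichotomy a b with h1 | h1 | h1
    · exact absurd hab (hmono a b h1 (by omega)).ne
    · exact h1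
    · exact absurd hab (hmono b a h1 (by omega)).ne'
  set P := Lagrange.interpolate (Finset.range (k + 1)) z (fun i => G 0 (z i)) with hPdef
  have hPdeg : P.degree < (k + 1 : ℕ) := by
    have := Lagrange.degree_interpolate_lt (fun i => G 0 (z i)) hinj
    rwa [Finset.card_range] at this
  have hPz : ∀ i ≤ k, P.eval (z i) = G 0 (z i) := fun i hi =>
    Lagrange.eval_interpolate_at_node _ hinj (by simpa [Nat.lt_succ_iff] using hi)
  set U : ℕ → ℝ → ℝ := fun i t => G i t - (Polynomial.derivative^[i] P).eval t with hU
  have hUd : ∀ i < k + 1, ∀ t ∈ Icc a (a + h), HasDerivAt (U i) (U (i + 1) t) t :=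
    fun i hi t ht => (hG i hi t ht).sub (hasDerivAt_eval_iterate_derivative P i t)
  obtain ⟨s', hs', hz'⟩ := exists_zeros_iterated_deriv (a := a) (b := a + h) j (k + 1 - j) (U := U)
    (s := (Finset.range (k + 1)).image z) (fun i hi => hUd i (by omega))
    (by rw [Finset.card_image_of_injOn hinj, Finset.card_range]; omega) (by
      intro w hw
      obtain ⟨i, hi, rfl⟩ := Finset.mem_image.1 hw
      have hik : i ≤ k := by simpa [Nat.lt_succ_iff] using hi
      exact ⟨hzI i hik, by simp [hU, hPz i hik]⟩)
  have hPtop : Polynomial.derivative^[k + 1] P = 0 := by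
    by_cases hP0 : P = 0
    · simp [hP0]
    · exact Polynomial.iterate_derivative_eq_zero ((Polynomial.natDegree_lt_iff_degree_lt hP0).2 hPdeg)
  -- The difference of G 0 and its interpolant has k + 1 zeros, so its j-th derivative has k + 1 -
  -- j; its derivative of order k + 1 is that of G 0, the interpolant having degree at most k.
  have h1 := abs_le_of_zeros (a := a) (b := a + h) (A := A) (k := k + 1 - j)
    (U := fun i => U (j + i)) (s := s') (x := x) (fun i hi t ht => hUd (j + i) (by omega) t ht)
    (fun t ht => by
      have : j + (k + 1 - j) = k + 1 := by omega
      simp only [this, hU, hPtop, Polynomial.eval_zero, sub_zero]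
      exact hA t ht) hs' hz' hx
  rw [add_sub_cancel_left] at h1
  have h2 := abs_eval_iterate_derivative_le (x := x) (h := h) (ε := ε) hs hz hPdeg
    (fun i hi => by rw [hPz i hi]; exact hzG i hi)
    (fun i hi => by
      have := hzI i hi
      rw [abs_le]; constructor <;> linarith [this.1, this.2, hx.1, hx.2]) hj
  have h3 : G j x = U (j + 0) x + (Polynomial.derivative^[j] P).eval x := by simp [hU]
  rw [h3]
  exact (abs_add_le _ _).trans (add_le_add h1 h2)

end RemezSmooth

/-! ### The one-dimensional Remez inequality -/

namespace RemezSmooth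

theorem exists_dense_subinterval {S : Set ℝ} (hS : S ⊆ Icc 0 1) {m : ℝ}
    (hm : ENNReal.ofReal m ≤ volume S) {p : ℕ} (hp : 1 ≤ p) :
    ∃ i < p, ENNReal.ofReal (m / p) ≤ volume (S ∩ Icc ((i : ℝ) / p) (i / p + 1 / p)) := by
  by_contra hcon
  push Not at hcon
  have hp0 : (0 : ℝ) < p := by exact_mod_cast hp
  have hcover : S ⊆ ⋃ i ∈ Finset.range p, S ∩ Icc ((i : ℝ) / p) (i / p + 1 / p) := by
    intro t ht
    obtain ⟨h0, h1⟩ := hS ht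
    simp only [Finset.mem_range, mem_iUnion, exists_prop]
    rcases h1.eq_or_lt with rfl | h1
    · refine ⟨p - 1, by omega, ht, ?_, ?_⟩
      · rw [div_le_one hp0]; exact_mod_cast Nat.sub_le _ _
      · rw [Nat.cast_sub hp, ← add_div]; field_simp; simp
    · have hf1 := Nat.floor_le (mul_nonneg h0 hp0.le)
      have hf2 := Nat.lt_floor_add_one (t * p)
      refine ⟨⌊t * p⌋₊, ?_, ht, ?_, ?_⟩
      · rw [Nat.floor_lt (mul_nonneg h0 hp0.le)]; nlinarith
      · rwa [div_le_iff₀ hp0]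
      · rw [← add_div, le_div_iff₀ hp0]; exact hf2.le
  have h1 : volume S < ∑ i ∈ Finset.range p, ENNReal.ofReal (m / p) := by
    refine ((measure_mono hcover).trans (measure_biUnion_finset_le _ _)).trans_lt ?_
    exact ENNReal.sum_lt_sum_of_nonempty ⟨0, Finset.mem_range.2 hp⟩
      fun i hi => hcon i (Finset.mem_range.1 hi)
  rw [Finset.sum_const, Finset.card_range, nsmul_eq_mul, ← ENNReal.ofReal_natCast,
    ← ENNReal.ofReal_mul hp0.le, mul_div_cancel₀ _ hp0.ne'] at h1
  exact absurd h1 (not_lt.2 hm)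

theorem prod_weight_le_mul_pow {lam : ℕ → ℝ} (hpos : ∀ j, 1 ≤ j → 0 < lam j)
    (hmono : ∀ j k, 1 ≤ j → j ≤ k → lam j ≤ lam k) {j k : ℕ} (hjk : j ≤ k) :
    ∏ i ∈ Finset.Icc 1 k, lam i ≤ (∏ i ∈ Finset.Icc 1 j, lam i) * lam k ^ (k - j) := by
  rcases Nat.eq_zero_or_pos k with rfl | hk
  · simp [show j = 0 by omega]
  have hdisj : Finset.Icc 1 k = Finset.Icc 1 j ∪ Finset.Ioc j k := by
    ext; simp; omega
  rw [hdisj, Finset.prod_union (by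
    rw [Finset.disjoint_left]; intro a; simp; omega)]
  refine mul_le_mul_of_nonneg_left ?_ (Finset.prod_nonneg fun i hi =>
    (hpos i (Finset.mem_Icc.1 hi).1).le)
  refine (Finset.prod_le_prod (g := fun _ => lam k) (fun i hi => ?_) fun i hi => ?_).trans_eq ?_
  · have := Finset.mem_Ioc.1 hi
    exact (hpos i (by omega)).le
  · have := Finset.mem_Ioc.1 hi
    exact hmono i k (by omega) this.2
  · simp

/-- Multiplying the lower bounds for lam 1, …, lam j gives lam q ^ j (j!/q^j)^γ, and q^j/j! ≤ e^q.
This is where the factor exp(2nγ) of the final constant arises. -/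
theorem pow_mul_exp_le_prod_weight {lam : ℕ → ℝ} {q : ℕ} (hq : 1 ≤ q) (hL : 0 < lam q) {γ : ℝ}
    (hγ0 : 0 ≤ γ) (hγ : ∀ j, 1 ≤ j → j ≤ q → lam q * ((j : ℝ) / q) ^ γ ≤ lam j) {j : ℕ}
    (hj : j ≤ q) : lam q ^ j * Real.exp (-(q * γ)) ≤ ∏ i ∈ Finset.Icc 1 j, lam i := by
  have hq0 : (0 : ℝ) < q := by exact_mod_cast hq
  have hfac : ∏ i ∈ Finset.Icc 1 j, i = j.factorial := by
    clear hj
    induction j with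
    | zero => simp
    | succ j ih => rw [Finset.prod_Icc_succ_top (by omega), ih, Nat.factorial_succ, mul_comm]
  have h1 : ∏ i ∈ Finset.Icc 1 j, (lam q * ((i : ℝ) / q) ^ γ) ≤ ∏ i ∈ Finset.Icc 1 j, lam i := by
    refine Finset.prod_le_prod (fun i hi => by positivity) fun i hi => ?_
    have := Finset.mem_Icc.1 hi
    exact hγ i this.1 (by omega)
  refine le_trans ?_ h1
  rw [Finset.prod_mul_distrib, Finset.prod_const, Nat.card_Icc, Nat.add_sub_cancel,
    Real.finsetProd_rpow _ _ (fun i _ => by positivity), Finset.prod_div_distrib,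
    Finset.prod_const, Nat.card_Icc, Nat.add_sub_cancel, ← Nat.cast_prod, hfac]
  refine mul_le_mul_of_nonneg_left ?_ (by positivity)
  rw [← neg_mul, Real.exp_mul]
  refine Real.rpow_le_rpow (Real.exp_pos _).le ?_ hγ0
  have h2 := Real.pow_div_factorial_le_exp (x := (q : ℝ)) hq0.le j
  rw [Real.exp_neg, inv_le_comm₀ (Real.exp_pos _) (by positivity), inv_div]
  exact h2

/-- The Remez inequality on the unit interval for a function that attains its maximum at `0`. -/
theorem one_le_mul_of_small_on {G : ℕ → ℝ → ℝ} {lam : ℕ → ℝ} {n : ℕ} (hn : 1 ≤ n)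
    (hpos : ∀ j, 1 ≤ j → 0 < lam j) (hmono : ∀ j k, 1 ≤ j → j ≤ k → lam j ≤ lam k)
    {γ : ℝ} (hγ0 : 0 ≤ γ)
    (hγ : ∀ j, 1 ≤ j → j ≤ 2 * n → lam (2 * n) * ((j : ℝ) / (2 * n : ℕ)) ^ γ ≤ lam j)
    (hderiv : ∀ j < 2 * n, ∀ t ∈ Icc (0 : ℝ) 1, HasDerivAt (G j) (G (j + 1) t) t)
    (hG : ∀ j ≤ 2 * n, ∀ t ∈ Icc (0 : ℝ) 1, |G j t| ≤ ∏ i ∈ Finset.Icc 1 j, lam i)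
    (h0 : |G 0 0| = 1)
    (hsumlt : ∑ i ∈ Finset.Icc 1 n, 1 / lam i < Real.exp 1)
    (hsum : Real.exp 1 ≤ ∑ i ∈ Finset.Icc 1 (n + 1), 1 / lam i)
    {S : Set ℝ} (hS : IsCompact S) (hS01 : S ⊆ Icc 0 1) {ε : ℝ} (hSε : ∀ t ∈ S, |G 0 t| ≤ ε)
    {m : ℝ} (hm : 0 < m) (hmS : ENNReal.ofReal m ≤ volume S) :
    1 ≤ ε * (2 / m) ^ (2 * n - 1) *
      (2 * 4 ^ n * Real.exp (5 * n + 1 + (2 * n : ℕ) * γ)) := by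
  have hn0 : (0 : ℝ) < n := by exact_mod_cast hn
  have hn1 : (1 : ℝ) ≤ n := by exact_mod_cast hn
  set L := lam (2 * n) with hLdef
  have hL : 0 < L := hpos _ (by omega)
  have he := Real.exp_pos 1
  -- The first n reciprocals sum to less than e and each is at least 1/L. This makes the real number
  -- rounded up in p at least 1, so that rounding costs at most a factor 2.
  have hLn : (n : ℝ) / Real.exp 1 < L := by
    have h1 : ∑ i ∈ Finset.Icc 1 n, 1 / L ≤ ∑ i ∈ Finset.Icc 1 n, 1 / lam i := by
      refine Finset.sum_le_sum fun i hi => ?_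
      have := Finset.mem_Icc.1 hi
      exact one_div_le_one_div_of_le (hpos i this.1) (hmono _ _ this.1 (by omega))
    rw [Finset.sum_const, Nat.card_Icc, Nat.add_sub_cancel, nsmul_eq_mul, mul_one_div] at h1
    have h2 := h1.trans_lt hsumlt
    rw [div_lt_iff₀ hL] at h2
    rw [div_lt_iff₀ he]
    linarith
  set p := ⌈L * Real.exp 3 / n⌉₊ with hpdef
  have hx1 : 1 ≤ L * Real.exp 3 / n := by
    rw [one_le_div hn0]
    have h1 : Real.exp 1 ≤ Real.exp 3 := Real.exp_le_exp.2 (by norm_num)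
    rw [div_lt_iff₀ he] at hLn
    nlinarith
  have hp1 : L * Real.exp 3 / n ≤ p := Nat.le_ceil _
  have hp2 : (p : ℝ) ≤ 2 * (L * Real.exp 3 / n) := by
    have := Nat.ceil_lt_add_one (zero_le_one.trans hx1)
    rw [← hpdef] at this
    linarith
  have hp0 : (0 : ℝ) < p := by linarith
  have hp : 1 ≤ p := by exact_mod_cast hp0
  obtain ⟨i, hip, hi⟩ := exists_dense_subinterval hS01 hmS hp
  set h : ℝ := 1 / p with hh
  set a : ℝ := (i : ℝ) / p with ha
  have hh0 : 0 < h := by positivity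
  have hLh1 : L * h ≤ n / Real.exp 3 := by
    rw [hh, mul_one_div, div_le_div_iff₀ hp0 (Real.exp_pos 3)]
    rw [div_le_iff₀ hn0] at hp1
    linarith
  have hLh2 : n / (2 * Real.exp 3) ≤ L * h := by
    rw [hh, mul_one_div, div_le_div_iff₀ (by positivity) hp0]
    rw [← mul_div_assoc, le_div_iff₀ hn0] at hp2
    linarith
  have hI : Icc a (a + h) ⊆ Icc 0 1 := by
    refine Icc_subset_Icc (by positivity) ?_
    rw [ha, hh, ← add_div, div_le_one hp0]
    exact_mod_cast hip
  -- The chosen subinterval holds measure at least m h = 2n s > (2n - 1) s, enough for 2n points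
  -- with gaps at least s.
  set s : ℝ := m * h / (2 * n) with hs
  have hs0 : 0 < s := by positivity
  have hk : 2 * n - 1 + 1 = 2 * n := by omega
  obtain ⟨z, hz1, hz2⟩ := exists_spaced_points hs0 (2 * n - 1) (hS.inter_right isClosed_Icc)
    (lt_of_lt_of_le ((ENNReal.ofReal_lt_ofReal_iff (by positivity)).2 (by
      rw [Nat.cast_sub (by omega), hs]
      push_cast
      have : m / p = 2 * n * (m * h / (2 * n)) := by rw [hh]; field_simp
      rw [this]
      nlinarith)) hi)
  have haI : a ∈ Icc a (a + h) := ⟨le_rfl, by linarith⟩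
  obtain ⟨j, hjn, hj⟩ := exists_large_deriv hpos hmono (fun j hj => hderiv j (by omega))
    (fun j hj => hG j (by omega)) h0 hsum (hI haI)
  have hnode := abs_deriv_le_of_nodes (G := G) (k := 2 * n - 1) (j := j) (x := a) (ε := ε)
    (A := ∏ i ∈ Finset.Icc 1 (2 * n), lam i) hs0
    (fun i hi t ht => hderiv i (by omega) t (hI ht))
    (fun t ht => by rw [hk]; exact hG _ le_rfl t (hI ht))
    (fun i hi => (hz1 i hi).2) (fun i hi => hSε _ (hz1 i hi).1) hz2 haI (by omega)
  rw [hk] at hnode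
  have hε : 0 ≤ ε := (abs_nonneg _).trans (hSε _ (hz1 0 (by omega)).1)
  set Mj := ∏ i ∈ Finset.Icc 1 j, lam i with hMj
  have hMj0 : 0 < Mj := Finset.prod_pos fun i hi => hpos i (Finset.mem_Icc.1 hi).1
  -- The interpolation error is at most half of Bang's lower bound: with q = 2n - j ≥ n one has L h
  -- ≤ q/e³, hence (L h)^q/q! ≤ exp(-2q). This is what the e³ in p is for.
  have hfirst : (∏ i ∈ Finset.Icc 1 (2 * n), lam i) * h ^ (2 * n - j) / (2 * n - j).factorial ≤
      1 / 2 * (Real.exp (j - (n + 1)) * Mj) := by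
    set q := 2 * n - j with hq
    have hqn : (n : ℝ) ≤ q := by exact_mod_cast (show n ≤ q by omega)
    have h1 := prod_weight_le_mul_pow hpos hmono (show j ≤ 2 * n by omega)
    have h2 : (L * h) ^ q / q.factorial ≤ Real.exp (-2 * q) := by
      calc (L * h) ^ q / q.factorial ≤ (q / Real.exp 3) ^ q / q.factorial := by
            gcongr
            exact hLh1.trans (by gcongr)
        _ = ((q : ℝ) ^ q / q.factorial) * Real.exp (-3 * q) := by
            rw [div_pow, ← Real.exp_nat_mul, neg_mul, Real.exp_neg, mul_comm (q : ℝ) 3]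
            field_simp
        _ ≤ Real.exp q * Real.exp (-3 * q) := by
            gcongr
            exact Real.pow_div_factorial_le_exp (q : ℝ) (Nat.cast_nonneg q) q
        _ = _ := by rw [← Real.exp_add]; congr 1; ring
    have h3 : Real.exp (-2 * q) ≤ 1 / 2 * Real.exp (j - (n + 1)) := by
      have h4 : Real.exp (-1) ≤ 1 / 2 := by
        rw [Real.exp_neg, ← one_div]
        exact one_div_le_one_div_of_le (by norm_num) (by linarith [Real.exp_one_gt_d9])
      have h5 : (j : ℝ) + q = 2 * n := by exact_mod_cast (show j + q = 2 * n by omega)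
      calc Real.exp (-2 * q) ≤ Real.exp (-1 + (j - (n + 1))) := Real.exp_le_exp.2 (by linarith)
        _ = Real.exp (-1) * Real.exp (j - (n + 1)) := Real.exp_add _ _
        _ ≤ _ := by gcongr
    calc (∏ i ∈ Finset.Icc 1 (2 * n), lam i) * h ^ q / q.factorial
        ≤ (Mj * L ^ q) * h ^ q / q.factorial := by gcongr
      _ = Mj * ((L * h) ^ q / q.factorial) := by rw [mul_pow]; ring
      _ ≤ Mj * (1 / 2 * Real.exp (j - (n + 1))) := by gcongr; exact h2.trans h3
      _ = _ := by ring
  have hsecond : 1 / 2 * (Real.exp (j - (n + 1)) * Mj) ≤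
      ε * (2 / s) ^ (2 * n - 1) * (h ^ (2 * n - 1 - j) / (2 * n - 1 - j).factorial) := by
    linarith
  -- Multiplying both sides of `hsecond` by h^j removes the unknown scale: M_j h^j is compared with
  -- (L h)^j, and L h ≥ n/(2e³), while on the other side all powers of h cancel.
  have hlow : (n / (2 * Real.exp 3)) ^ j * Real.exp (-((2 * n : ℕ) * γ)) ≤ Mj * h ^ j := by
    have h1 := pow_mul_exp_le_prod_weight (lam := lam) (q := 2 * n) (by omega) hL hγ0 hγ
      (show j ≤ 2 * n by omega)
    calc (n / (2 * Real.exp 3)) ^ j * Real.exp (-((2 * n : ℕ) * γ))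
        ≤ (L * h) ^ j * Real.exp (-((2 * n : ℕ) * γ)) := by gcongr
      _ = (L ^ j * Real.exp (-((2 * n : ℕ) * γ))) * h ^ j := by rw [mul_pow]; ring
      _ ≤ Mj * h ^ j := by gcongr
  have hup : (2 / s) ^ (2 * n - 1) * (h ^ (2 * n - 1 - j) / (2 * n - 1 - j).factorial) * h ^ j ≤
      (2 / m) ^ (2 * n - 1) * ((2 * n) ^ j * Real.exp (2 * n)) := by
    set q := 2 * n - 1 - j with hq
    have hqj : 2 * n - 1 = q + j := by omega
    have h1 : 2 / s = 2 / m * (2 * n) / h := by rw [hs]; field_simp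
    have h2 := Real.pow_div_factorial_le_exp (x := (2 * n : ℝ)) (by positivity) q
    calc (2 / s) ^ (2 * n - 1) * (h ^ q / q.factorial) * h ^ j
        = (2 / m) ^ (2 * n - 1) * ((2 * n) ^ j * ((2 * n) ^ q / q.factorial)) := by
          rw [h1, hqj, div_pow, mul_pow, pow_add (2 * n : ℝ), pow_add h]
          field_simp
      _ ≤ _ := by gcongr
  have hcomb : 1 / 2 * Real.exp (j - (n + 1)) *
      ((n / (2 * Real.exp 3)) ^ j * Real.exp (-((2 * n : ℕ) * γ))) ≤
      ε * ((2 / m) ^ (2 * n - 1) * ((2 * n) ^ j * Real.exp (2 * n))) := by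
    calc 1 / 2 * Real.exp (j - (n + 1)) *
          ((n / (2 * Real.exp 3)) ^ j * Real.exp (-((2 * n : ℕ) * γ)))
        ≤ 1 / 2 * Real.exp (j - (n + 1)) * (Mj * h ^ j) := by gcongr
      _ = (1 / 2 * (Real.exp (j - (n + 1)) * Mj)) * h ^ j := by ring
      _ ≤ (ε * (2 / s) ^ (2 * n - 1) * (h ^ (2 * n - 1 - j) / (2 * n - 1 - j).factorial)) * h ^ j := by
          gcongr
      _ = ε * ((2 / s) ^ (2 * n - 1) * (h ^ (2 * n - 1 - j) / (2 * n - 1 - j).factorial) * h ^ j) := by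
          ring
      _ ≤ _ := by gcongr
  set W := Real.exp (5 * n + 1 + (2 * n : ℕ) * γ) with hW
  have hjn' : (j : ℝ) ≤ n := by exact_mod_cast hjn
  set a₀ := 1 / 2 * Real.exp (j - (n + 1)) *
      ((n / (2 * Real.exp 3)) ^ j * Real.exp (-((2 * n : ℕ) * γ))) with ha₀
  set b₀ : ℝ := (2 * n) ^ j * Real.exp (2 * n) with hb₀
  have ha₀pos : 0 < a₀ := by positivity
  -- The powers n^j cancel; what remains is 4^j ≤ 4^n and an exponent of at most 5n + 1 + 2nγ, by j
  -- ≤ n.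
  have hba : b₀ ≤ a₀ * (2 * 4 ^ n * W) := by
    have h1 : a₀ * (2 * 4 ^ n * W) = (n / 2) ^ j * 4 ^ n *
        Real.exp (j - (n + 1) + (-((2 * n : ℕ) * γ)) + (5 * n + 1 + (2 * n : ℕ) * γ) - 3 * j) := by
      have h3 : (n / (2 * Real.exp 3)) ^ j = ((n : ℝ) / 2) ^ j * Real.exp (-(3 * j)) := by
        rw [← div_div, div_pow, ← Real.exp_nat_mul, Real.exp_neg, mul_comm (3 : ℝ), div_eq_mul_inv]
      rw [ha₀, hW, h3, sub_eq_add_neg _ (3 * (j : ℝ)), Real.exp_add _ (-(3 * (j : ℝ))),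
        Real.exp_add _ (5 * (n : ℝ) + 1 + _), Real.exp_add ((j : ℝ) - _)]
      ring
    rw [h1, hb₀]
    have h2 : ((2 : ℝ) * n) ^ j ≤ (n / 2) ^ j * 4 ^ n := by
      calc ((2 : ℝ) * n) ^ j = (n / 2) ^ j * 4 ^ j := by rw [← mul_pow]; ring
        _ ≤ _ := by gcongr; norm_num
    refine mul_le_mul h2 (Real.exp_le_exp.2 ?_) (Real.exp_pos _).le (by positivity)
    linarith
  have hfin : a₀ * 1 ≤ a₀ * (ε * (2 / m) ^ (2 * n - 1) * (2 * 4 ^ n * W)) := by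
    calc a₀ * 1 = a₀ := mul_one _
      _ ≤ ε * ((2 / m) ^ (2 * n - 1) * b₀) := hcomb
      _ ≤ ε * ((2 / m) ^ (2 * n - 1) * (a₀ * (2 * 4 ^ n * W))) := by gcongr
      _ = _ := by ring
  exact le_of_mul_le_mul_left hfin ha₀pos

end RemezSmooth

/-! ### The growth exponent of the interpolated weight -/

namespace RemezSmooth

theorem leftDeriv_eq_derivWithin_Icc {g : ℝ → ℝ} {a b s : ℝ} (ha : a < s) (hs : s ≤ b) (h1 : s ≠ 1)
    (hg : DifferentiableWithinAt ℝ g (Icc a b) s) : leftDeriv g s = derivWithin g (Icc a b) s := by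
  have hu : UniqueDiffWithinAt ℝ (Icc a s) s :=
    (uniqueDiffOn_Icc ha).uniqueDiffWithinAt ⟨ha.le, le_rfl⟩
  rw [leftDeriv, if_neg h1, ← derivWithin_subset (Icc_subset_Icc_right hs) hu hg]
  refine (derivWithin_congr_set ?_).symm
  filter_upwards [Ici_mem_nhds ha] with x hx
  simp only [mem_Ici] at hx
  exact propext ⟨fun h => h.2, fun h => ⟨hx, h⟩⟩

theorem leftDeriv_one_eq_derivWithin_Icc {g : ℝ → ℝ} {b : ℝ} (hb : 1 < b) :
    leftDeriv g 1 = derivWithin g (Icc 1 b) 1 := by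
  rw [leftDeriv, if_pos rfl]
  refine derivWithin_congr_set ?_
  filter_upwards [Iic_mem_nhds hb] with x hx
  simp only [mem_Iic] at hx
  exact propext ⟨fun h => ⟨h, hx⟩, fun h => h.1⟩

namespace IsInterpolation

variable {μ : ℕ → ℝ} {g : ℝ → ℝ}

theorem leftDeriv_nonneg (h : IsInterpolation μ g) {s : ℝ} (hs : 1 ≤ s) : 0 ≤ leftDeriv g s := by
  obtain rfl | hs := hs.eq_or_lt
  · rw [leftDeriv, if_pos rfl]
    exact h.mono.derivWithin_nonneg
  · have h1 : leftDeriv g s = derivWithin g (Icc 1 s) s := by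
      rw [leftDeriv, if_neg hs.ne']
      refine derivWithin_congr_set ?_
      filter_upwards [Ici_mem_nhds hs] with x hx
      simp only [mem_Ici] at hx
      exact propext ⟨fun h => ⟨hx, h⟩, fun h => h.2⟩
    rw [h1]
    exact (h.mono.mono Icc_subset_Ici_self).derivWithin_nonneg

/-- On each closed piece the one-sided derivatives are continuous, and finitely many pieces reach n.
Boundedness is essential, since the real supremum defining `gammaExp` has a default value on
unbounded families. -/
theorem bddAbove_logDeriv (h : IsInterpolation μ g) (n : ℕ) :
    BddAbove (range fun s : Icc (1 : ℝ) n => (s : ℝ) * leftDeriv g s / g s) := by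
  obtain ⟨t, ht, ht0, httop, htd⟩ := h.piecewise
  have ht1 : ∀ i, 1 ≤ t i := fun i => ht0 ▸ ht.monotone (Nat.zero_le i)
  have hpiece : ∀ i, ∃ B, 0 ≤ B ∧ ∀ s ∈ Icc (t i) (t (i + 1)),
      s * derivWithin g (Icc (t i) (t (i + 1))) s / g s ≤ B := by
    intro i
    have hlt := ht (Nat.lt_succ_self i)
    have hc : ContinuousOn (fun s => s * derivWithin g (Icc (t i) (t (i + 1))) s / g s)
        (Icc (t i) (t (i + 1))) := by
      refine (continuousOn_id.mul ((htd i).continuousOn_derivWithin (uniqueDiffOn_Icc hlt)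
        le_rfl)).div (htd i).continuousOn fun s hs => (h.pos s ((ht1 i).trans hs.1)).ne'
    obtain ⟨B, hB⟩ := isCompact_Icc.bddAbove_image hc
    exact ⟨max B 0, le_max_right _ _, fun s hs =>
      (hB (mem_image_of_mem _ hs)).trans (le_max_left _ _)⟩
  choose B hB0 hB using hpiece
  obtain ⟨I, hI⟩ := (httop.eventually_ge_atTop (n : ℝ)).exists
  refine ⟨∑ i ∈ Finset.range (I + 1), B i, ?_⟩
  rintro _ ⟨⟨s, hs1, hsn⟩, rfl⟩
  simp only
  obtain ⟨i, hiI, hi, hd⟩ : ∃ i ≤ I, s ∈ Icc (t i) (t (i + 1)) ∧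
      leftDeriv g s = derivWithin g (Icc (t i) (t (i + 1))) s := by
    obtain rfl | hs1 := hs1.eq_or_lt
    · refine ⟨0, Nat.zero_le _, ⟨ht0.le, ?_⟩, ?_⟩
      · exact ht0 ▸ (ht (Nat.lt_succ_self 0)).le
      · have := ht (Nat.lt_succ_self 0)
        rw [ht0] at this ⊢
        exact leftDeriv_one_eq_derivWithin_Icc this
    -- The least such k selects the piece with t i < s ≤ t (i+1), so that a breakpoint is treated as
    -- a right end, as the left derivative requires.
    · have hex : ∃ k, s ≤ t k := ⟨I, hsn.trans hI⟩
      classical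
      have hk := Nat.find_spec hex
      have hkI : Nat.find hex ≤ I := Nat.find_min' hex (hsn.trans hI)
      obtain ⟨i, hi⟩ : ∃ i, Nat.find hex = i + 1 := by
        refine Nat.exists_eq_succ_of_ne_zero fun h0 => ?_
        rw [h0, ht0] at hk
        linarith
      have hlt : t i < s := not_le.1 (Nat.find_min hex (by omega))
      rw [hi] at hk
      refine ⟨i, by omega, ⟨hlt.le, hk⟩, leftDeriv_eq_derivWithin_Icc hlt hk hs1.ne' ?_⟩
      exact ((htd i).differentiableOn one_ne_zero) s ⟨hlt.le, hk⟩
  rw [hd]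
  refine (hB i s hi).trans ?_
  exact Finset.single_le_sum (f := B) (fun i _ => hB0 i) (Finset.mem_range.2 (by omega))

theorem gammaExp_nonneg (h : IsInterpolation μ g) {n : ℕ} (hn : 1 ≤ n) : 0 ≤ gammaExp g n := by
  have hn' : (1 : ℝ) ≤ n := by exact_mod_cast hn
  refine le_trans ?_ (le_ciSup (h.bddAbove_logDeriv n) ⟨1, le_rfl, hn'⟩)
  exact div_nonneg (mul_nonneg zero_le_one (h.leftDeriv_nonneg le_rfl)) (h.pos 1 le_rfl).le

/-- The derivative g'/g - γ/s is nonpositive inside each piece by the definition of γ; continuity of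
g glues the pieces. Comparing the values at j and n gives the power lower bound on μ j. -/
theorem antitoneOn_log_sub (h : IsInterpolation μ g) (n : ℕ) :
    AntitoneOn (fun s => Real.log (g s) - gammaExp g n * Real.log s) (Icc 1 (n : ℝ)) := by
  obtain ⟨t, ht, ht0, httop, htd⟩ := h.piecewise
  have ht1 : ∀ i, 1 ≤ t i := fun i => ht0 ▸ ht.monotone (Nat.zero_le i)
  set φ : ℝ → ℝ := fun s => Real.log (g s) - gammaExp g n * Real.log s with hφ
  have hpiece : ∀ i, AntitoneOn φ (Icc (t i) (t (i + 1)) ∩ Iic (n : ℝ)) := by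
    intro i
    have hsub1 : ∀ s ∈ Icc (t i) (t (i + 1)) ∩ Iic (n : ℝ), 1 ≤ s := fun s hs => (ht1 i).trans hs.1.1
    have hder : ∀ s ∈ interior (Icc (t i) (t (i + 1)) ∩ Iic (n : ℝ)),
        HasDerivAt φ (leftDeriv g s / g s - gammaExp g n * s⁻¹) s := by
      intro s hs
      rw [interior_inter, interior_Icc, interior_Iic] at hs
      obtain ⟨⟨hs1, hs2⟩, hs3⟩ := hs
      have hs1' : 1 < s := (ht1 i).trans_lt hs1
      have hdw := (htd i).differentiableOn one_ne_zero s ⟨hs1.le, hs2.le⟩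
      have hd : HasDerivAt g (leftDeriv g s) s := by
        rw [leftDeriv_eq_derivWithin_Icc hs1 hs2.le hs1'.ne' hdw]
        exact hdw.hasDerivWithinAt.hasDerivAt (Icc_mem_nhds hs1 hs2)
      exact (hd.log (h.pos s hs1'.le).ne').sub ((Real.hasDerivAt_log (by linarith)).const_mul _)
    refine antitoneOn_of_deriv_nonpos ((convex_Icc _ _).inter (convex_Iic _)) ?_
      (fun s hs => (hder s hs).differentiableAt.differentiableWithinAt) ?_
    · refine ContinuousOn.sub (ContinuousOn.log (h.cont.mono fun s hs => hsub1 s hs)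
        fun s hs => (h.pos s (hsub1 s hs)).ne') (continuousOn_const.mul
        (continuousOn_id.log fun s hs => ?_))
      have := hsub1 s hs
      simp only [id]
      linarith
    · intro s hs
      rw [(hder s hs).deriv]
      have hs' := interior_subset hs
      have hs1 := hsub1 s hs'
      have hg := h.pos s hs1
      have hle : s * leftDeriv g s / g s ≤ gammaExp g n :=
        le_ciSup (h.bddAbove_logDeriv n) ⟨s, hs1, hs'.2⟩
      rw [sub_nonpos, ← div_eq_mul_inv, le_div_iff₀ (by linarith)]
      refine le_of_eq_of_le ?_ hle
      ring
  have hglue : ∀ i, AntitoneOn φ (Icc 1 (t i) ∩ Iic (n : ℝ)) := by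
    intro i
    induction i with
    | zero =>
      rw [ht0, Icc_self]
      exact (subsingleton_singleton.anti inter_subset_left).antitoneOn _
    | succ i ih =>
      intro x hx y hy hxy
      rcases le_total y (t i) with h1 | h1
      · exact ih ⟨⟨hx.1.1, hxy.trans h1⟩, hx.2⟩ ⟨⟨hy.1.1, h1⟩, hy.2⟩ hxy
      rcases le_total (t i) x with h2 | h2
      · exact hpiece i ⟨⟨h2, hx.1.2⟩, hx.2⟩ ⟨⟨h1, hy.1.2⟩, hy.2⟩ hxy
      have h3 : t i ≤ (n : ℝ) := h1.trans hy.2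
      exact (hpiece i ⟨⟨le_rfl, (ht (Nat.lt_succ_self i)).le⟩, h3⟩ ⟨⟨h1, hy.1.2⟩, hy.2⟩ h1).trans
        (ih ⟨⟨hx.1.1, h2⟩, hx.2⟩ ⟨⟨ht1 i, le_rfl⟩, h3⟩ h2)
  obtain ⟨I, hI⟩ := (httop.eventually_ge_atTop (n : ℝ)).exists
  exact (hglue I).mono fun x hx => ⟨⟨hx.1, hx.2.trans hI⟩, hx.2⟩

/-- Values of the weight are controlled from below by the growth exponent. -/
theorem mul_rpow_le (h : IsInterpolation μ g) {j n : ℕ} (hj : 1 ≤ j) (hjn : j ≤ n) :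
    μ n * ((j : ℝ) / n) ^ gammaExp g n ≤ μ j := by
  have hj1 : (1 : ℝ) ≤ j := by exact_mod_cast hj
  have hjn' : (j : ℝ) ≤ n := by exact_mod_cast hjn
  have h1 := h.antitoneOn_log_sub n ⟨hj1, hjn'⟩ ⟨hj1.trans hjn', le_rfl⟩ hjn'
  simp only [h.interp j hj, h.interp n (hj.trans hjn)] at h1
  have hμj : 0 < μ j := h.interp j hj ▸ h.pos j hj1
  have hμn : 0 < μ n := h.interp n (hj.trans hjn) ▸ h.pos n (hj1.trans hjn')
  have hj0 : (0 : ℝ) < j := by linarith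
  have hn0 : (0 : ℝ) < n := by linarith
  rw [← Real.log_le_log_iff (by positivity) hμj, Real.log_mul hμn.ne' (by positivity),
    Real.log_rpow (by positivity), Real.log_div hj0.ne' hn0.ne']
  linarith

end IsInterpolation

end RemezSmooth

/-! ### Partial derivatives and restriction to lines -/

namespace RemezSmooth

variable {d : ℕ} {U : Set (EuclideanSpace ℝ (Fin d))} {f g : EuclideanSpace ℝ (Fin d) → ℝ}

theorem partialDeriv_eqOn_fderiv (hU : IsOpen U) (hf : ContDiffOn ℝ 1 f U) (i : Fin d) :
    EqOn (partialDeriv i f) (fun x => fderiv ℝ f x (EuclideanSpace.single i 1)) U := fun _ hx =>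
  ((hf.differentiableOn one_ne_zero).differentiableAt (hU.mem_nhds hx)).lineDeriv_eq_fderiv

theorem contDiffOn_partialDeriv (hU : IsOpen U) {m : ℕ} (hf : ContDiffOn ℝ (m + 1 : ℕ) f U)
    (i : Fin d) : ContDiffOn ℝ m (partialDeriv i f) U := by
  have h1 : ContDiffOn ℝ m (fderiv ℝ f) U := hf.fderiv_of_isOpen hU (by norm_cast)
  exact (h1.clm_apply contDiffOn_const).congr
    (partialDeriv_eqOn_fderiv hU (hf.of_le (by norm_cast; omega)) i)

theorem partialDeriv_congr (hU : IsOpen U) (h : EqOn f g U) (i : Fin d) :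
    EqOn (partialDeriv i f) (partialDeriv i g) U := fun _ hx =>
  (h.eventuallyEq_of_mem (hU.mem_nhds hx)).lineDeriv_eq

theorem partialDeriv_comm (hU : IsOpen U) (hf : ContDiffOn ℝ 2 f U) (i k : Fin d) :
    EqOn (partialDeriv i (partialDeriv k f)) (partialDeriv k (partialDeriv i f)) U := by
  have h1 : ContDiffOn ℝ 1 (fderiv ℝ f) U := hf.fderiv_of_isOpen hU (by norm_num)
  have key : ∀ i k, ∀ x ∈ U, partialDeriv i (partialDeriv k f) x =
      fderiv ℝ (fderiv ℝ f) x (EuclideanSpace.single i 1) (EuclideanSpace.single k 1) := by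
    intro i k x hx
    have h2 : DifferentiableAt ℝ (fderiv ℝ f) x :=
      (h1.differentiableOn one_ne_zero).differentiableAt (hU.mem_nhds hx)
    rw [partialDeriv_congr hU (partialDeriv_eqOn_fderiv hU (hf.of_le (by norm_num)) k) i hx]
    have h3 : DifferentiableAt ℝ (fun x => fderiv ℝ f x (EuclideanSpace.single k 1)) x :=
      h2.clm_apply (differentiableAt_const _)
    rw [partialDeriv, h3.lineDeriv_eq_fderiv, fderiv_clm_apply h2 (differentiableAt_const _)]
    simp
  intro x hx
  have hs : IsSymmSndFDerivAt ℝ f x :=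
    (hf.contDiffAt (hU.mem_nhds hx)).isSymmSndFDerivAt (by simp)
  rw [key i k x hx, key k i x hx, hs.eq]

/-- Iterated partial derivatives along a word of indices. -/
noncomputable def wordDeriv (l : List (Fin d)) (f : EuclideanSpace ℝ (Fin d) → ℝ) :
    EuclideanSpace ℝ (Fin d) → ℝ :=
  l.foldr partialDeriv f

/-- The sorted word that contains each index `i` exactly `α i` times. -/
def sortedWord (α : Fin d → ℕ) : List (Fin d) :=
  (List.finRange d).flatMap fun i => List.replicate (α i) i

theorem multiDeriv_eq_wordDeriv (α : Fin d → ℕ) : multiDeriv α f = wordDeriv (sortedWord α) f := by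
  unfold multiDeriv wordDeriv sortedWord
  induction List.finRange d with
  | nil => rfl
  | cons i l ih =>
    rw [List.foldr_cons, List.flatMap_cons, List.foldr_append, ← ih]
    generalize List.foldr _ f l = g
    induction α i with
    | zero => rfl
    | succ m ihm => rw [Function.iterate_succ_apply', ihm, List.replicate_succ, List.foldr_cons]

theorem count_sortedWord (α : Fin d → ℕ) (i : Fin d) : (sortedWord α).count i = α i := by
  rw [sortedWord, List.count_flatMap, ← Fin.sum_univ_def]
  simp [List.count_replicate]

theorem length_sortedWord (α : Fin d → ℕ) : (sortedWord α).length = ∑ i, α i := by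
  rw [sortedWord, List.length_flatMap, ← Fin.sum_univ_def]
  simp

theorem contDiffOn_wordDeriv (hU : IsOpen U) {n : ℕ} (l : List (Fin d)) {m : ℕ}
    (hm : m + l.length ≤ n) (hf : ContDiffOn ℝ n f U) : ContDiffOn ℝ m (wordDeriv l f) U := by
  induction l generalizing m with
  | nil => exact hf.of_le (by simpa using hm)
  | cons i l ih =>
    rw [List.length_cons] at hm
    exact contDiffOn_partialDeriv hU (ih (m := m + 1) (by omega)) i

/-- Adjacent swaps generate all permutations, and each swap is the symmetry of second derivatives.
Hence a partial derivative applied in front of `multiDeriv α f` can be moved to its sorted place. -/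
theorem wordDeriv_perm (hU : IsOpen U) {n : ℕ} (hf : ContDiffOn ℝ n f U) {l l' : List (Fin d)}
    (hl : l.Perm l') (hn : l.length ≤ n) : EqOn (wordDeriv l f) (wordDeriv l' f) U := by
  induction hl with
  | nil => exact fun _ _ => rfl
  | cons i _ ih =>
    rw [List.length_cons] at hn
    exact partialDeriv_congr hU (ih (by omega)) i
  | swap i k l =>
    simp only [List.length_cons] at hn
    exact partialDeriv_comm hU (contDiffOn_wordDeriv hU l (m := 2) (by omega) hf) k i
  | trans h1 _ ih1 ih2 => exact (ih1 hn).trans (ih2 (h1.length_eq ▸ hn))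

theorem partialDeriv_multiDeriv (hU : IsOpen U) {n : ℕ} (hf : ContDiffOn ℝ n f U) {α : Fin d → ℕ}
    (hα : ∑ i, α i < n) (i : Fin d) :
    EqOn (partialDeriv i (multiDeriv α f)) (multiDeriv (α + Pi.single i 1) f) U := by
  rw [multiDeriv_eq_wordDeriv, multiDeriv_eq_wordDeriv]
  refine wordDeriv_perm hU hf (l := i :: sortedWord α) (List.perm_iff_count.2 fun k => ?_) ?_
  · rw [List.count_cons, count_sortedWord, count_sortedWord]
    by_cases h : k = i
    · subst h; simp
    · simp [h, Ne.symm h]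
  · rw [List.length_cons, length_sortedWord]; omega

theorem contDiffOn_multiDeriv (hU : IsOpen U) {n : ℕ} (hf : ContDiffOn ℝ n f U) {α : Fin d → ℕ}
    {m : ℕ} (hα : m + ∑ i, α i ≤ n) : ContDiffOn ℝ m (multiDeriv α f) U := by
  rw [multiDeriv_eq_wordDeriv]
  exact contDiffOn_wordDeriv hU _ (by rwa [length_sortedWord]) hf

theorem hasDerivAt_comp_line (hU : IsOpen U) (hg : ContDiffOn ℝ 1 g U)
    {x v : EuclideanSpace ℝ (Fin d)} {t : ℝ} (ht : x + t • v ∈ U) :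
    HasDerivAt (fun t : ℝ => g (x + t • v)) (∑ i, v i * partialDeriv i g (x + t • v)) t := by
  have h1 : HasFDerivAt g (fderiv ℝ g (x + t • v)) (x + t • v) :=
    ((hg.differentiableOn one_ne_zero).differentiableAt (hU.mem_nhds ht)).hasFDerivAt
  have h2 : HasDerivAt (fun t : ℝ => x + t • v) v t := by
    simpa using ((hasDerivAt_id t).smul_const v).const_add x
  have h3 := h1.comp_hasDerivAt t h2
  have h4 : v = ∑ i, v i • EuclideanSpace.single i (1 : ℝ) := by
    ext k
    simp [Finset.sum_apply, Pi.single_apply]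
  have h5 : fderiv ℝ g (x + t • v) v = ∑ i, v i * partialDeriv i g (x + t • v) := by
    nth_rewrite 2 [h4]
    rw [map_sum]
    refine Finset.sum_congr rfl fun i _ => ?_
    rw [map_smul, partialDeriv_eqOn_fderiv hU hg i ht, smul_eq_mul]
  rw [← h5]
  exact h3

/-- Pascal's rule for multinomial coefficients: (j+1)!/β! = ∑ β_i j!/β!, and the i-th summand is
matched with α = β - e_i; where β_i = 0 it vanishes. This is the passage from the j-th to the
(j+1)-st derivative along a line. -/
theorem sum_multinomial_succ (v : Fin d → ℝ) (Φ : (Fin d → ℕ) → ℝ) (j : ℕ) :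
    ∑ α ∈ Finset.piAntidiag Finset.univ j, ((j.factorial : ℝ) / ∏ i, ((α i).factorial : ℝ)) *
        (∏ i, v i ^ α i) * ∑ i, v i * Φ (α + Pi.single i 1) =
      ∑ β ∈ Finset.piAntidiag Finset.univ (j + 1),
        (((j + 1).factorial : ℝ) / ∏ i, ((β i).factorial : ℝ)) * (∏ i, v i ^ β i) * Φ β := by
  have h1 : ∀ β ∈ Finset.piAntidiag (Finset.univ : Finset (Fin d)) (j + 1),
      (((j + 1).factorial : ℝ) / ∏ i, ((β i).factorial : ℝ)) * (∏ i, v i ^ β i) * Φ β =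
      ∑ i, (β i : ℝ) * (((j.factorial : ℝ) / ∏ i, ((β i).factorial : ℝ)) *
        (∏ i, v i ^ β i) * Φ β) := by
    intro β hβ
    rw [← Finset.sum_mul, ← Nat.cast_sum, (Finset.mem_piAntidiag.1 hβ).1, Nat.factorial_succ]
    push_cast
    ring
  rw [Finset.sum_congr rfl h1, Finset.sum_comm]
  simp_rw [Finset.mul_sum]
  rw [Finset.sum_comm]
  refine Finset.sum_congr rfl fun i _ => ?_
  refine Finset.sum_of_injOn (fun α => α + Pi.single i 1) (fun a _ b _ h => add_right_cancel h) ?_ ?_ ?_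
  · intro α hα
    simp only [Finset.mem_coe, Finset.mem_piAntidiag] at hα ⊢
    refine ⟨?_, fun _ _ => Finset.mem_univ _⟩
    simp [Finset.sum_add_distrib, hα.1]
  · intro β hβ hβ'
    have : β i = 0 := by
      by_contra h
      refine hβ' ⟨β - Pi.single i 1, ?_, ?_⟩
      · have hle : Pi.single i 1 ≤ β := by
          intro k
          by_cases hk : k = i
          · subst hk; simpa using Nat.one_le_iff_ne_zero.2 h
          · simp [hk]
        simp only [Finset.mem_coe, Finset.mem_piAntidiag]
        refine ⟨?_, fun _ _ => Finset.mem_univ _⟩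
        have h2 : ∑ k, (β - Pi.single i 1 + Pi.single i 1 : Fin d → ℕ) k = j + 1 := by
          rw [tsub_add_cancel_of_le hle]; exact (Finset.mem_piAntidiag.1 hβ).1
        simp only [Pi.add_apply, Finset.sum_add_distrib, Finset.sum_pi_single', Finset.mem_univ,
          if_true] at h2
        change ∑ k, (β - Pi.single i 1 : Fin d → ℕ) k = j
        omega
      · ext k
        by_cases hk : k = i
        · subst hk; simp; omega
        · simp [hk]
    simp [this]
  · intro α hα
    have h2 : ∏ k, (((α + Pi.single i 1 : Fin d → ℕ) k).factorial : ℝ) =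
        (α i + 1) * ∏ k, ((α k).factorial : ℝ) := by
      have : ∀ k, (((α + Pi.single i 1 : Fin d → ℕ) k).factorial : ℝ) =
          (if k = i then (α i + 1 : ℝ) else 1) * ((α k).factorial : ℝ) := by
        intro k
        by_cases hk : k = i
        · subst hk; simp [Nat.factorial_succ]
        · simp [hk]
      simp_rw [this]
      rw [Finset.prod_mul_distrib, Finset.prod_ite_eq' Finset.univ i]
      simp
    have h3 : ∏ k, v k ^ (α + Pi.single i 1 : Fin d → ℕ) k = v i * ∏ k, v k ^ α k := by
      simp_rw [Pi.add_apply, pow_add]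
      rw [Finset.prod_mul_distrib, mul_comm]
      congr 1
      rw [Finset.prod_eq_single i (fun k _ hk => by simp [hk]) (by simp)]
      simp
    have h4 : ((α i : ℝ) + 1) ≠ 0 := by positivity
    have h5 : ∏ k, ((α k).factorial : ℝ) ≠ 0 :=
      Finset.prod_ne_zero_iff.2 fun k _ => by positivity
    rw [h2, h3]
    simp only [Pi.add_apply, Pi.single_eq_same]
    push_cast
    field_simp

/-- The derivative of order `j` of the function `t ↦ f (x + t v)`. -/
noncomputable def lineJet (f : EuclideanSpace ℝ (Fin d) → ℝ) (x v : EuclideanSpace ℝ (Fin d)) (j : ℕ) (t : ℝ) : ℝ :=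
  ∑ α ∈ Finset.piAntidiag (Finset.univ : Finset (Fin d)) j,
    ((j.factorial : ℝ) / ∏ i, ((α i).factorial : ℝ)) * (∏ i, v i ^ α i) *
      multiDeriv α f (x + t • v)

theorem lineJet_zero (x v : EuclideanSpace ℝ (Fin d)) (t : ℝ) :
    lineJet f x v 0 t = f (x + t • v) := by
  rw [lineJet, Finset.piAntidiag_zero, Finset.sum_singleton, multiDeriv_eq_wordDeriv]
  have : sortedWord (0 : Fin d → ℕ) = [] := List.length_eq_zero_iff.1 (by simp [length_sortedWord])
  simp [this, wordDeriv]

theorem hasDerivAt_lineJet (hU : IsOpen U) {n : ℕ} (hf : ContDiffOn ℝ n f U)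
    {x v : EuclideanSpace ℝ (Fin d)} {t : ℝ} (ht : x + t • v ∈ U) {j : ℕ} (hj : j < n) :
    HasDerivAt (lineJet f x v j) (lineJet f x v (j + 1) t) t := by
  unfold lineJet
  rw [← sum_multinomial_succ]
  refine HasDerivAt.fun_sum fun α hα => ?_
  have hαj : ∑ i, α i = j := (Finset.mem_piAntidiag.1 hα).1
  have h1 := hasDerivAt_comp_line hU
    (contDiffOn_multiDeriv hU hf (α := α) (m := 1) (by omega)) ht
  have h2 : ∑ i, v i * partialDeriv i (multiDeriv α f) (x + t • v) =
      ∑ i, v i * multiDeriv (α + Pi.single i 1) f (x + t • v) :=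
    Finset.sum_congr rfl fun i _ => by
      rw [partialDeriv_multiDeriv hU hf (by omega) i ht]
  rw [h2] at h1
  exact h1.const_mul _

theorem abs_lineJet_le {K : Set (EuclideanSpace ℝ (Fin d))} (hK : IsCompact K) (hU : IsOpen U)
    (hKU : K ⊆ U) {n : ℕ} (hf : ContDiffOn ℝ n f U) {x v : EuclideanSpace ℝ (Fin d)} {t δ : ℝ}
    (ht : x + t • v ∈ K) (hv : ‖v‖ ≤ δ) {j : ℕ} (hj : j ≤ n) :
    |lineJet f x v j t| ≤ δ ^ j * derivNorm j K f := by
  rw [lineJet, derivNorm, Finset.mul_sum]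
  refine (Finset.abs_sum_le_sum_abs _ _).trans (Finset.sum_le_sum fun α hα => ?_)
  have hαj : ∑ i, α i = j := (Finset.mem_piAntidiag.1 hα).1
  have hδ : 0 ≤ δ := (norm_nonneg _).trans hv
  have hc : ContinuousOn (multiDeriv α f) K :=
    (contDiffOn_multiDeriv hU hf (m := 0) (by omega)).continuousOn.mono hKU
  have hbdd : BddAbove (range fun y : K => |multiDeriv α f y|) := by
    obtain ⟨B, hB⟩ := hK.bddAbove_image hc.abs
    exact ⟨B, by rintro _ ⟨y, rfl⟩; exact hB (mem_image_of_mem _ y.2)⟩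
  have h1 : |multiDeriv α f (x + t • v)| ≤ supNorm K (multiDeriv α f) := le_ciSup hbdd ⟨_, ht⟩
  have h2 : |∏ i, v i ^ α i| ≤ δ ^ j := by
    rw [Finset.abs_prod, ← hαj, ← Finset.prod_pow_eq_pow_sum]
    refine Finset.prod_le_prod (fun _ _ => abs_nonneg _) fun i _ => ?_
    rw [abs_pow]
    exact pow_le_pow_left₀ (abs_nonneg _) ((PiLp.norm_apply_le v i).trans hv) _
  rw [abs_mul, abs_mul, abs_of_nonneg (a := (j.factorial : ℝ) / ∏ i, ((α i).factorial : ℝ))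
    (by positivity)]
  calc _ ≤ ((j.factorial : ℝ) / ∏ i, ((α i).factorial : ℝ)) * δ ^ j * supNorm K (multiDeriv α f) := by
        gcongr
    _ = _ := by ring

end RemezSmooth

/-! ### Polar coordinates and segments from a point -/

namespace RemezSmooth

open scoped Pointwise

theorem lintegral_Ioc_pow (k : ℕ) {a : ℝ} (ha : 0 ≤ a) :
    ∫⁻ r in Ioc 0 a, ENNReal.ofReal (r ^ k) = ENNReal.ofReal (a ^ (k + 1) / (k + 1)) := by
  rw [← ofReal_integral_eq_lintegral_ofReal (intervalIntegral.intervalIntegrable_pow _).1,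
    ← intervalIntegral.integral_of_le ha]
  · simp
  · filter_upwards [ae_restrict_mem measurableSet_Ioc] with y hy
    exact pow_nonneg hy.1.le _

/-- Among sets of given length in the half line, the initial interval minimizes `∫ r ^ k`. -/
theorem ofReal_pow_le_lintegral_pow (k : ℕ) {A : Set ℝ} (hA : MeasurableSet A) (hA0 : A ⊆ Ioi 0)
    {a : ℝ} (ha : 0 ≤ a) (haA : ENNReal.ofReal a ≤ volume A) :
    ENNReal.ofReal (a ^ (k + 1) / (k + 1)) ≤ ∫⁻ r in A, ENNReal.ofReal (r ^ k) := by
  rw [← lintegral_Ioc_pow k ha]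
  have h1 : ∫⁻ r in A, ENNReal.ofReal (r ^ k) = (∫⁻ r in A ∩ Ioc 0 a, ENNReal.ofReal (r ^ k)) +
      ∫⁻ r in A \ Ioc 0 a, ENNReal.ofReal (r ^ k) :=
    (lintegral_inter_add_sdiff _ _ measurableSet_Ioc).symm
  have h2 : ∫⁻ r in Ioc 0 a, ENNReal.ofReal (r ^ k) = (∫⁻ r in A ∩ Ioc 0 a, ENNReal.ofReal (r ^ k)) +
      ∫⁻ r in Ioc 0 a \ A, ENNReal.ofReal (r ^ k) := by
    rw [inter_comm]
    exact (lintegral_inter_add_sdiff _ _ hA).symm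
  rw [h1, h2]
  refine add_le_add_right ?_ _
  -- The part of A beyond a has at least the measure of the part of (0, a] that A misses, and r^k is
  -- at least a^k on the former, at most a^k on the latter.
  have h3 : volume (Ioc 0 a \ A) ≤ volume (A \ Ioc 0 a) := by
    have h4 := measure_inter_add_sdiff (μ := volume) A (measurableSet_Ioc (a := (0 : ℝ)) (b := a))
    have h5 := measure_inter_add_sdiff (μ := volume) (Ioc 0 a) hA
    rw [inter_comm, Real.volume_Ioc, sub_zero] at h5
    have hfin : volume (A ∩ Ioc 0 a) ≠ ∞ :=
      ((measure_mono inter_subset_right).trans_lt measure_Ioc_lt_top).ne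
    refine (ENNReal.add_le_add_iff_left hfin).1 ?_
    rw [h4, h5]
    exact haA
  calc ∫⁻ r in Ioc 0 a \ A, ENNReal.ofReal (r ^ k)
      ≤ ∫⁻ _ in Ioc 0 a \ A, ENNReal.ofReal (a ^ k) :=
        setLIntegral_mono' (measurableSet_Ioc.diff hA) fun r hr =>
          ENNReal.ofReal_le_ofReal (pow_le_pow_left₀ hr.1.1.le hr.1.2 k)
    _ = ENNReal.ofReal (a ^ k) * volume (Ioc 0 a \ A) := setLIntegral_const _ _
    _ ≤ ENNReal.ofReal (a ^ k) * volume (A \ Ioc 0 a) := by gcongr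
    _ = ∫⁻ _ in A \ Ioc 0 a, ENNReal.ofReal (a ^ k) := (setLIntegral_const _ _).symm
    _ ≤ _ := setLIntegral_mono' (hA.diff measurableSet_Ioc) fun r hr => by
        refine ENNReal.ofReal_le_ofReal (pow_le_pow_left₀ ha ?_ k)
        by_contra h
        exact hr.2 ⟨hA0 hr.1, (not_le.1 h).le⟩

variable {V : Type*} [NormedAddCommGroup V] [NormedSpace ℝ V] [MeasurableSpace V] [BorelSpace V]
  [FiniteDimensional ℝ V] (μ : Measure V) [μ.IsAddHaarMeasure]

/-- The measure of a set in polar coordinates. -/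
theorem measure_eq_lintegral_toSphere [Nontrivial V] {A : Set V} (hA : MeasurableSet A) :
    μ A = ∫⁻ θ, (∫⁻ r in {r : ℝ | 0 < r ∧ r • (θ : V) ∈ A},
      ENNReal.ofReal (r ^ (Module.finrank ℝ V - 1))) ∂μ.toSphere := by
  set B : Set (Metric.sphere (0 : V) 1 × Ioi (0 : ℝ)) := {p | (p.2 : ℝ) • (p.1 : V) ∈ A} with hB
  have hBm : MeasurableSet B := by
    have : Continuous fun p : Metric.sphere (0 : V) 1 × Ioi (0 : ℝ) => (p.2 : ℝ) • (p.1 : V) := by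
      fun_prop
    exact this.measurable hA
  have h1 := (μ.measurePreserving_homeomorphUnitSphereProd).measure_preimage hBm.nullMeasurableSet
  have h2 : homeomorphUnitSphereProd V ⁻¹' B = Subtype.val ⁻¹' A := by
    ext w
    simp only [hB, mem_preimage, mem_ofPred_eq, homeomorphUnitSphereProd_apply_fst_coe,
      homeomorphUnitSphereProd_apply_snd_coe]
    rw [smul_smul, mul_inv_cancel₀ (norm_ne_zero_iff.2 w.2), one_smul]
  rw [h2, comap_subtype_coe_apply (measurableSet_singleton _).compl, Subtype.image_preimage_coe,
    Measure.prod_apply hBm] at h1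
  have h3 : μ (({0}ᶜ : Set V) ∩ A) = μ A := by
    rw [inter_comm, ← sdiff_eq, measure_sdiff_null (measure_singleton _)]
  rw [← h3, h1]
  refine lintegral_congr fun θ => ?_
  have hm : MeasurableSet (Prod.mk θ ⁻¹' B) := measurable_prodMk_left hBm
  rw [Measure.volumeIoiPow, withDensity_apply _ hm,
    setLIntegral_subtype measurableSet_Ioi _ fun a : ℝ => ENNReal.ofReal (a ^ _)]
  congr 2
  ext r
  simp [hB, and_comm]

/-- If every segment from `x` meets `E` in a small proportion, then `E` occupies a small
part of the convex body `K`. -/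
theorem ofReal_pow_mul_measure_le_of_segments [Nontrivial V] {K E : Set V} (hK : Convex ℝ K)
    (hKc : IsCompact K) (hE : MeasurableSet E) {x : V} (hx : x ∈ K) {m : ℝ} (hm1 : m ≤ 1)
    (hm0 : 0 ≤ m)
    (hseg : ∀ y ∈ K, volume {t : ℝ | t ∈ Icc (0 : ℝ) 1 ∧ x + t • (y - x) ∈ E} ≤ ENNReal.ofReal m) :
    ENNReal.ofReal ((1 - m) ^ Module.finrank ℝ V) * μ K ≤ μ (K \ E) := by
  obtain ⟨k, hk⟩ : ∃ k, Module.finrank ℝ V = k + 1 :=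
    Nat.exists_eq_succ_of_ne_zero (Module.finrank_pos (R := ℝ) (M := V)).ne'
  have hKm : MeasurableSet K := hKc.isClosed.measurableSet
  have hadd : Measurable fun v : V => x + v := (continuous_const.add continuous_id).measurable
  rw [← measure_preimage_add μ x K, ← measure_preimage_add μ x (K \ E),
    measure_eq_lintegral_toSphere μ (hadd hKm), measure_eq_lintegral_toSphere μ (hadd (hKm.diff hE)),
    hk, Nat.add_sub_cancel, ← lintegral_const_mul' _ _ ENNReal.ofReal_ne_top]
  refine lintegral_mono fun θ => ?_
  have hθ : ‖(θ : V)‖ = 1 := by simp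
  have hline : Continuous fun r : ℝ => x + r • (θ : V) := by fun_prop
  by_cases hne : ∃ r : ℝ, 0 < r ∧ x + r • (θ : V) ∈ K
  swap
  · have : {r : ℝ | 0 < r ∧ r • (θ : V) ∈ (fun v => x + v) ⁻¹' K} = ∅ := by
      ext r
      simp only [mem_preimage, mem_ofPred_eq, mem_empty_iff_false, iff_false]
      exact fun h => hne ⟨r, h⟩
    simp only [this]
    simp
  obtain ⟨r₀, hr₀, hr₀K⟩ := hne
  have hC : IsCompact {r : ℝ | x + r • (θ : V) ∈ K} := by
    refine Metric.isCompact_of_isClosed_isBounded (hKc.isClosed.preimage hline) ?_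
    obtain ⟨B, hB⟩ := hKc.isBounded.exists_norm_le
    refine (Metric.isBounded_closedBall (x := (0 : ℝ)) (r := B + ‖x‖)).subset fun r hr => ?_
    rw [mem_closedBall_zero_iff]
    have h1 : ‖r • (θ : V)‖ = ‖r‖ := by rw [norm_smul, hθ, mul_one]
    have h2 : r • (θ : V) = (x + r • (θ : V)) - x := by abel
    rw [← h1, h2]
    exact (norm_sub_le _ _).trans (add_le_add_left (hB _ hr) _)
  obtain ⟨R, hRK, hRmax⟩ := hC.exists_isGreatest ⟨r₀, hr₀K⟩
  have hR : 0 < R := hr₀.trans_le (hRmax hr₀K)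
  set S : Set ℝ := {t : ℝ | t ∈ Icc (0 : ℝ) 1 ∧ x + t • ((x + R • (θ : V)) - x) ∈ E} with hS
  set A : Set ℝ := Ioc 0 R ∩ {r : ℝ | x + r • (θ : V) ∉ E} with hA
  have hAm : MeasurableSet A := measurableSet_Ioc.inter (hline.measurable hE).compl
  -- R is the exit parameter of the ray. By the hypothesis on the segment ending at x + Rθ, the set
  -- E takes at most length m R of (0, R].
  have hAvol : ENNReal.ofReal ((1 - m) * R) ≤ volume A := by
    have h1 : Ioc 0 R \ ((fun t => R * t) '' S) ⊆ A := by
      rintro r ⟨hr, hrS⟩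
      refine ⟨hr, fun hrE => hrS ⟨r / R, ⟨⟨(div_pos hr.1 hR).le, (div_le_one hR).2 hr.2⟩, ?_⟩, ?_⟩⟩
      · rw [add_sub_cancel_left, smul_smul, div_mul_cancel₀ _ hR.ne']
        exact hrE
      · field_simp
    refine le_trans ?_ ((le_measure_sdiff).trans (measure_mono h1))
    have h2 : volume ((fun t => R * t) '' S) ≤ ENNReal.ofReal (R * m) := by
      have := Measure.addHaar_smul (volume : Measure ℝ) R S
      rw [Module.finrank_self, pow_one, abs_of_pos hR] at this
      change volume (R • S) ≤ _
      rw [this, ENNReal.ofReal_mul hR.le]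
      gcongr
      exact hseg _ hRK
    rw [Real.volume_Ioc, sub_zero]
    calc ENNReal.ofReal ((1 - m) * R) = ENNReal.ofReal R - ENNReal.ofReal (R * m) := by
          rw [← ENNReal.ofReal_sub _ (by positivity)]; congr 1; ring
      _ ≤ _ := tsub_le_tsub_left h2 _
  calc ENNReal.ofReal ((1 - m) ^ (k + 1)) *
        ∫⁻ r in {r : ℝ | 0 < r ∧ r • (θ : V) ∈ (fun v => x + v) ⁻¹' K}, ENNReal.ofReal (r ^ k)
      ≤ ENNReal.ofReal ((1 - m) ^ (k + 1)) * ∫⁻ r in Ioc 0 R, ENNReal.ofReal (r ^ k) := by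
        gcongr
        exact fun r hr => ⟨hr.1, hRmax hr.2⟩
    _ = ENNReal.ofReal (((1 - m) * R) ^ (k + 1) / (k + 1)) := by
        rw [lintegral_Ioc_pow k hR.le, ← ENNReal.ofReal_mul (pow_nonneg (by linarith) _), mul_pow,
          mul_div_assoc]
    _ ≤ ∫⁻ r in A, ENNReal.ofReal (r ^ k) :=
        ofReal_pow_le_lintegral_pow k hAm (fun r hr => hr.1.1)
          (mul_nonneg (by linarith) hR.le) hAvol
    _ ≤ ∫⁻ r in {r : ℝ | 0 < r ∧ r • (θ : V) ∈ (fun v => x + v) ⁻¹' (K \ E)},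
          ENNReal.ofReal (r ^ k) := by
        refine lintegral_mono_set fun r hr => ⟨hr.1.1, ?_, hr.2⟩
        have h1 := hK.add_smul_sub_mem hx hRK
          (⟨(div_pos hr.1.1 hR).le, (div_le_one hR).2 hr.1.2⟩ : r / R ∈ Icc (0 : ℝ) 1)
        rwa [add_sub_cancel_left, smul_smul, div_mul_cancel₀ _ hR.ne'] at h1

end RemezSmooth

/-! ### Choice of the segment, constants and conclusion -/

namespace RemezSmooth

theorem bddAbove_abs_of_continuousOn {d : ℕ} {K S : Set (EuclideanSpace ℝ (Fin d))}
    {f : EuclideanSpace ℝ (Fin d) → ℝ} (hK : IsCompact K) (hSK : S ⊆ K) (hf : ContinuousOn f K) :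
    BddAbove (range fun x : S => |f x|) := by
  obtain ⟨B, hB⟩ := hK.bddAbove_image hf.abs
  exact ⟨B, by rintro _ ⟨y, rfl⟩; exact hB (mem_image_of_mem _ (hSK y.2))⟩

theorem startIndex_one : startIndex 1 = 0 := by simp [startIndex]

/-- The two inequalities that characterize the associated integer. -/
theorem weightSum_of_associated {lam : ℕ → ℝ} (hpos : ∀ j, 1 ≤ j → 0 ≤ lam j) {n : ℕ} (hn : 1 ≤ n)
    (h : ((n + 1 : ℕ) : ℕ∞) = weightDegree lam 1 + 1) :
    weightSum lam 1 n < Real.exp 1 ∧ Real.exp 1 ≤ weightSum lam 1 (n + 1) := by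
  have hdeg : weightDegree lam 1 = n := by
    push_cast at h
    exact (ENat.add_left_injective_of_ne_top ENat.one_ne_top h).symm
  rw [weightDegree, startIndex_one] at hdeg
  constructor
  · have h1 : ((n - 1 : ℕ) : ℕ∞) < ⨆ k ∈ {k : ℕ | weightSum lam (0 + 1) k < Real.exp 1}, (k : ℕ∞) := by
      rw [hdeg]; exact_mod_cast (by omega)
    obtain ⟨k, hk⟩ := lt_iSup_iff.1 h1
    obtain ⟨hkm, hk⟩ := lt_iSup_iff.1 hk
    have hnk : n ≤ k := by
      have : n - 1 < k := by exact_mod_cast hk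
      omega
    refine lt_of_le_of_lt ?_ hkm
    refine Finset.sum_le_sum_of_subset_of_nonneg (Finset.Icc_subset_Icc le_rfl hnk) fun i hi _ => ?_
    exact one_div_nonneg.2 (hpos i (Finset.mem_Icc.1 hi).1)
  · by_contra hcon
    push Not at hcon
    have h1 : ((n + 1 : ℕ) : ℕ∞) ≤ n := by
      rw [← hdeg]
      exact le_iSup₂ (f := fun (k : ℕ) (_ : k ∈ {k : ℕ | weightSum lam (0 + 1) k < Real.exp 1}) =>
        (k : ℕ∞)) (n + 1) hcon
    have : n + 1 ≤ n := by exact_mod_cast h1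
    omega

/-- If the diameter were 0, all terms of the weight sums would be 1/0 = 0, the degree would be
infinite, and no natural number N could be associated. -/
theorem diam_pos_of_associated {d : ℕ} {μ : ℕ → ℝ} {K : Set (EuclideanSpace ℝ (Fin d))} {N : ℕ}
    (h : IsAssociatedInteger μ K N) : 0 < Metric.diam K := by
  refine lt_of_le_of_ne Metric.diam_nonneg fun h0 => ?_
  have htop : weightDegree (fun j => Metric.diam K * μ j) 1 = ⊤ := by
    refine ENat.eq_top_iff_forall_ge.2 fun k => ?_
    refine le_iSup₂ (f := fun (k : ℕ) (_ : k ∈ {k : ℕ | weightSum (fun j => Metric.diam K * μ j)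
      (startIndex 1 + 1) k < Real.exp 1}) => (k : ℕ∞)) k ?_
    simp [weightSum, ← h0, Real.exp_pos]
  rw [IsAssociatedInteger, htop, top_add] at h
  exact ENat.natCast_ne_top N h

/-- A segment emanating from `x` that meets `E` in at least half of the expected proportion. -/
theorem exists_segment {d : ℕ} (hd : 1 ≤ d) {K E : Set (EuclideanSpace ℝ (Fin d))}
    (hK : IsConvexBody K) (hE : MeasurableSet E) (hEK : E ⊆ K) {x : EuclideanSpace ℝ (Fin d)}
    (hx : x ∈ K) {m : ℝ} (hm0 : 0 < m) (hm1 : m ≤ 1)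
    (hm : (1 - m) ^ d * (volume K).toReal ≥ (volume K).toReal - (volume E).toReal) :
    ∃ y ∈ K, ENNReal.ofReal (m / 2) ≤
      volume {t : ℝ | t ∈ Icc (0 : ℝ) 1 ∧ x + t • (y - x) ∈ E} := by
  by_contra hcon
  push Not at hcon
  have : Nonempty (Fin d) := ⟨⟨0, hd⟩⟩
  -- Halving m makes the contradiction strict: (1 - m/2)^d > (1 - m)^d.
  have h1 := ofReal_pow_mul_measure_le_of_segments volume hK.convex hK.compact hE hx
    (m := m / 2) (by linarith) (by linarith) fun y hy => (hcon y hy).le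
  rw [finrank_euclideanSpace_fin] at h1
  have hKfin : volume K ≠ ∞ := hK.compact.measure_lt_top.ne
  have hEfin : volume E ≠ ∞ := ((measure_mono hEK).trans_lt hK.compact.measure_lt_top).ne
  rw [measure_sdiff hEK hE.nullMeasurableSet hEfin] at h1
  have h2 := ENNReal.toReal_mono (ENNReal.sub_ne_top hKfin) h1
  rw [ENNReal.toReal_mul, ENNReal.toReal_ofReal (pow_nonneg (by linarith) _),
    ENNReal.toReal_sub_of_le (measure_mono hEK) hKfin] at h2
  have hKpos : 0 < (volume K).toReal :=
    ENNReal.toReal_pos ((isOpen_interior.measure_pos volume hK.interior_nonempty).trans_le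
      (measure_mono interior_subset)).ne' hKfin
  have h3 : (1 - m) ^ d < (1 - m / 2) ^ d :=
    pow_lt_pow_left₀ (by linarith) (by linarith) (by omega)
  nlinarith

/-- One spare factor 4/m absorbs the 2, and 4^n ≤ e^(2n) leaves the exponent 7n + 1 ≤ 8n, which is
the 4 in 4 + γ taken 2n times. -/
theorem remez_constant_le {n : ℕ} (hn : 1 ≤ n) {m γ : ℝ} (hm : 0 < m) (hm1 : m ≤ 1) :
    (2 / (m / 2)) ^ (2 * n - 1) * (2 * 4 ^ n * Real.exp (5 * n + 1 + (2 * n : ℕ) * γ)) ≤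
      (4 * Real.exp (4 + γ) / m) ^ (2 * n) := by
  have h1 : (2 / (m / 2)) = 4 / m := by field_simp; norm_num
  have h2 : (4 * Real.exp (4 + γ) / m) ^ (2 * n) =
      (4 / m) ^ (2 * n - 1) * (4 / m * Real.exp ((2 * n : ℕ) * (4 + γ))) := by
    rw [mul_div_right_comm, mul_pow, ← Real.exp_nat_mul, ← mul_assoc, ← pow_succ]
    congr 3
    omega
  rw [h1, h2]
  have h3 : (4 : ℝ) ≤ Real.exp 2 := by
    have : Real.exp 2 = Real.exp 1 * Real.exp 1 := by rw [← Real.exp_add]; norm_num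
    nlinarith [Real.exp_one_gt_d9]
  have hn1 : (1 : ℝ) ≤ n := by exact_mod_cast hn
  refine mul_le_mul_of_nonneg_left ?_ (by positivity)
  calc 2 * 4 ^ n * Real.exp (5 * n + 1 + (2 * n : ℕ) * γ)
      ≤ 4 / m * Real.exp 2 ^ n * Real.exp (5 * n + 1 + (2 * n : ℕ) * γ) := by
        gcongr
        rw [le_div_iff₀ hm]; linarith
    _ = 4 / m * Real.exp (n * 2 + (5 * n + 1 + (2 * n : ℕ) * γ)) := by
        rw [← Real.exp_nat_mul, mul_assoc, ← Real.exp_add]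
    _ ≤ _ := by
        gcongr
        push_cast
        linarith

end RemezSmooth

theorem mainTheorem5 {d : ℕ} (hd : 1 ≤ d) (μ : ℕ → ℝ) (μt : ℝ → ℝ)
    (K : Set (EuclideanSpace ℝ (Fin d))) (N : ℕ)
    (hdata : RemezSmooth.IsAdmissibleData μ K)
    (hassoc : RemezSmooth.IsAssociatedInteger μ K N)
    (hN : 2 ≤ N)
    (hμt : RemezSmooth.IsInterpolation μ μt)
    (f : EuclideanSpace ℝ (Fin d) → ℝ)
    (hf : RemezSmooth.IsWeightSmooth μ ((2 * (N - 1) : ℕ) : ℕ∞) (RemezSmooth.supNorm K f) K f)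
    (E : Set (EuclideanSpace ℝ (Fin d))) (hEK : E ⊆ K)
    (hE : NullMeasurableSet E volume) (hEpos : 0 < volume E) :
    RemezSmooth.supNorm K f ≤
      (RemezSmooth.gammaConst μt (2 * (N - 1)) * (volume K).toReal ^ (1 / (d : ℝ)) /
        ((volume K).toReal ^ (1 / (d : ℝ)) -
          ((volume K).toReal - (volume E).toReal) ^ (1 / (d : ℝ)))) ^ (2 * (N - 1)) *
      RemezSmooth.supNorm E f := by
  obtain ⟨n, rfl⟩ : ∃ n, N = n + 1 := ⟨N - 1, by omega⟩
  have hn : 1 ≤ n := by omega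
  simp only [Nat.add_sub_cancel] at *
  obtain ⟨hw, hK, -⟩ := hdata
  obtain ⟨hM, ⟨U, hU, hKU, hfU⟩, hbound⟩ := hf
  replace hfU : ContDiffOn ℝ (2 * n : ℕ) f U := hfU
  have hδ := RemezSmooth.diam_pos_of_associated hassoc
  set δ := Metric.diam K with hδdef
  set lam : ℕ → ℝ := fun j => δ * μ j with hlam
  have hlpos : ∀ j, 1 ≤ j → 0 < lam j := fun j hj => mul_pos hδ (hw.pos j hj)
  have hlmono : ∀ j k, 1 ≤ j → j ≤ k → lam j ≤ lam k := fun j k hj hjk =>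
    mul_le_mul_of_nonneg_left (hw.mono j k hj hjk) hδ.le
  obtain ⟨hsum1, hsum2⟩ := RemezSmooth.weightSum_of_associated (fun j hj => (hlpos j hj).le) hn hassoc
  have hfc : ContinuousOn f K := hfU.continuousOn.mono hKU
  have hKne : K.Nonempty := hK.interior_nonempty.mono interior_subset
  obtain ⟨x, hxK, hxmax⟩ := hK.compact.exists_isMaxOn hKne hfc.abs
  set M := RemezSmooth.supNorm K f with hMdef
  have : Nonempty K := hKne.to_subtype
  have hxM : |f x| = M := by
    refine le_antisymm (le_ciSup (f := fun y : K => |f y|)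
      (RemezSmooth.bddAbove_abs_of_continuousOn hK.compact subset_rfl hfc) ⟨x, hxK⟩) ?_
    exact ciSup_le fun y => hxmax y.2
  set ε := RemezSmooth.supNorm E f with hε
  have hEε : ∀ y ∈ E, |f y| ≤ ε := fun y hy => le_ciSup (f := fun y : E => |f y|)
    (RemezSmooth.bddAbove_abs_of_continuousOn hK.compact hEK hfc) ⟨y, hy⟩
  -- Enlarging E to the sublevel set keeps |f| ≤ ε and gains compactness, needed for measurability
  -- and for the choice of nodes.
  set E' : Set (EuclideanSpace ℝ (Fin d)) := K ∩ {y | |f y| ≤ ε} with hE'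
  have hE'c : IsCompact E' := by
    refine hK.compact.of_isClosed_subset ?_ inter_subset_left
    exact hfc.abs.preimage_isClosed_of_isClosed hK.compact.isClosed isClosed_Iic
  have hEE' : E ⊆ E' := fun y hy => ⟨hEK hy, hEε y hy⟩
  have hKfin : volume K ≠ ∞ := hK.compact.measure_lt_top.ne
  have hEfin : volume E ≠ ∞ := ((measure_mono hEK).trans_lt hK.compact.measure_lt_top).ne
  set vK := (volume K).toReal with hvK
  set vE := (volume E).toReal with hvE
  have hvE0 : 0 < vE := ENNReal.toReal_pos hEpos.ne' hEfin
  have hvEK : vE ≤ vK := ENNReal.toReal_mono hKfin (measure_mono hEK)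
  have hvK0 : 0 < vK := hvE0.trans_le hvEK
  have hd0 : (0 : ℝ) < 1 / d := one_div_pos.2 (by exact_mod_cast hd)
  set a := vK ^ (1 / (d : ℝ)) with ha
  set b := (vK - vE) ^ (1 / (d : ℝ)) with hb
  have ha0 : 0 < a := Real.rpow_pos_of_pos hvK0 _
  have hb0 : 0 ≤ b := Real.rpow_nonneg (by linarith) _
  have hba : b < a := Real.rpow_lt_rpow (by linarith) (by linarith) hd0
  have had : a ^ d = vK := by
    rw [ha, one_div, Real.rpow_inv_natCast_pow hvK0.le (by omega)]
  have hbd : b ^ d = vK - vE := by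
    rw [hb, one_div, Real.rpow_inv_natCast_pow (by linarith) (by omega)]
  -- Chosen so that (1 - m)^d = (|K| - |E|)/|K|; the base of the power in the theorem is then
  -- `gammaConst` divided by m.
  set m := (a - b) / a with hm
  have hm0 : 0 < m := div_pos (by linarith) ha0
  have hm1 : m ≤ 1 := (div_le_one ha0).2 (by linarith)
  have hmd : (1 - m) ^ d * vK = vK - vE := by
    have : 1 - m = b / a := by rw [hm]; field_simp; ring
    rw [this, div_pow, had, hbd, div_mul_cancel₀ _ hvK0.ne']
  obtain ⟨y, hyK, hy⟩ := RemezSmooth.exists_segment hd hK hE'c.measurableSet inter_subset_left hxK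
    hm0 hm1 (by
      rw [ge_iff_le, hmd]
      exact sub_le_sub_left (ENNReal.toReal_mono
        ((measure_mono inter_subset_left).trans_lt hK.compact.measure_lt_top).ne
        (measure_mono hEE')) _)
  set v := y - x with hv
  have hvδ : ‖v‖ ≤ δ := by
    rw [hv, ← dist_eq_norm]
    exact Metric.dist_le_diam_of_mem hK.compact.isBounded hyK hxK
  have hseg : ∀ t ∈ Icc (0 : ℝ) 1, x + t • v ∈ K := fun t ht => hK.convex.add_smul_sub_mem hxK hyK ht
  have hcl : Continuous fun t : ℝ => x + t • v := by fun_prop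
  set S : Set ℝ := {t : ℝ | t ∈ Icc (0 : ℝ) 1 ∧ x + t • v ∈ E'} with hS
  have hSc : IsCompact S := isCompact_Icc.inter_right (hE'c.isClosed.preimage hcl)
  have hγ0 := hμt.gammaExp_nonneg (show 1 ≤ 2 * n by omega)
  have hmain := RemezSmooth.one_le_mul_of_small_on (lam := lam) (n := n) (S := S) (ε := ε / M)
    (G := fun j t => RemezSmooth.lineJet f x v j t / M) (γ := RemezSmooth.gammaExp μt (2 * n))
    (m := m / 2) hn hlpos hlmono hγ0
    (fun j hj hj2 => by
      have := mul_le_mul_of_nonneg_left (hμt.mul_rpow_le hj hj2) hδ.le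
      rw [← mul_assoc] at this
      exact this)
    (fun j hj t ht => (RemezSmooth.hasDerivAt_lineJet hU hfU (hKU (hseg t ht)) hj).div_const M)
    (fun j hj t ht => by
      rw [abs_div, abs_of_pos hM, div_le_iff₀ hM]
      refine (RemezSmooth.abs_lineJet_le hK.compact hU hKU hfU (hseg t ht) hvδ hj).trans ?_
      have h1 := hbound j (by exact_mod_cast hj)
      calc δ ^ j * RemezSmooth.derivNorm j K f
          ≤ δ ^ j * (M * ∏ i ∈ Finset.Icc 1 j, μ i) := by gcongr
        _ = _ := by
            rw [hlam, Finset.prod_mul_distrib, Finset.prod_const, Nat.card_Icc, Nat.add_sub_cancel]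
            ring)
    (by rw [RemezSmooth.lineJet_zero, zero_smul, add_zero, abs_div, hxM, abs_of_pos hM,
          div_self hM.ne'])
    hsum1 hsum2 hSc (fun t ht => ht.1)
    (fun t ht => by
      rw [RemezSmooth.lineJet_zero, abs_div, abs_of_pos hM]
      gcongr
      exact ht.2.2)
    (by linarith) hy
  have hε0 : 0 ≤ ε := Real.iSup_nonneg fun _ => abs_nonneg _
  have hC : RemezSmooth.gammaConst μt (2 * n) * a / (a - b) =
      4 * Real.exp (4 + RemezSmooth.gammaExp μt (2 * n)) / m := by
    rw [RemezSmooth.gammaConst, hm, div_div_eq_mul_div]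
  rw [hC]
  calc M = M * 1 := (mul_one M).symm
    _ ≤ M * (ε / M * (2 / (m / 2)) ^ (2 * n - 1) *
          (2 * 4 ^ n * Real.exp (5 * n + 1 + (2 * n : ℕ) * RemezSmooth.gammaExp μt (2 * n)))) := by
        gcongr
    _ = ((2 / (m / 2)) ^ (2 * n - 1) *
          (2 * 4 ^ n * Real.exp (5 * n + 1 + (2 * n : ℕ) * RemezSmooth.gammaExp μt (2 * n)))) * ε := by
        field_simp
    _ ≤ _ := by
        gcongr
        exact RemezSmooth.remez_constant_le hn hm0 hm1
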